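/- **Setting.** Let $c,E\in\mathbb{R}$ be parameters of a rotational travelling wave of the sine-Gordon equation $u_{tt}-u_{xx}+\sin u=0$, that is, either $c^2<1$ and $E<0$ (subluminal), or $c^2>1$ and $E>2$ (superluminal). A wave profile with these parameters is a function $f\in C^2(\mathbb{R},\mathbb{R})$ with $$(c^2-1)f''+\sin f=0,\qquad \tfrac12(c^2-1)(f')^2+1-\cos f=E .$$ Its stability spectrum $\sigma_{\mathcal L}$ is the set of $\lambda\in\mathbb{C}$ for which $$\lambda W_1=W_2,\qquad \lambda W_2=-(c^2-1)W_1''-\cos(f)\,W_1+2c\,W_2'$$ has a nontrivial solution $(W_1,W_2)$, $W_1\in C^2(\mathbb{R},\mathbb{C})$, $W_2\in C^1(\mathbb{R},\mathbb{C})$, that is bounded on $\mathbb{R}$. Let $K(k)=\int_0^{\pi/2}(1-k^2\sin^2y)^{-1/2}\,dy$, and put $k=\sqrt{2/(2-E)}$, $s=\sqrt{(2-E)/(2(1-c^2))}$ in the subluminal case, $k=\sqrt{2/E}$, $s=\sqrt{E/(2(c^2-1))}$ in the superluminal case. Let $\omega_1=K(k)/s$, $\omega_3=iK(\sqrt{1-k^2})/s$,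 and let $\wp$, $\zeta_w$ be the Weierstrass $\wp$ and zeta functions of the lattice $2\omega_1\mathbb{Z}+2\omega_3\mathbb{Z}$. For $\zeta\in\mathbb{C}\setminus\{0\}$ let $$\Omega^2(\zeta)=\frac1{64}\Big(-8(c^2-1)(E-1)-\frac{(c-1)^2}{\zeta^2}-16(c+1)^2\zeta^2\Big),$$ let $\Omega(\zeta)$ be either square root of $\Omega^2(\zeta)$, and let $$X(\zeta)=\frac{\zeta\big(-i(c-1)(E-1)-4i(c+1)\zeta^2-8\zeta\Omega(\zeta)\big)}{(c-1)^3(c+1)} .$$ Let $\nu=1$ if $-\frac{\pi}{2}<\arg X(\zeta)\le\frac{\pi}{2}$ and $\nu=-1$ otherwise. Let $\rho=\rho(\zeta)$ be any complex number, not a lattice point, with $$\wp(\rho)=-\frac{(c-1)(E-1)+12(c+1)\zeta^2-24i\zeta\Omega(\zeta)}{6(c-1)^2(c+1)},\qquad -\frac{\pi}{2}<\arg\wp'(\rho)\le\frac{\pi}{2}$$ (the second condition fixes the sign of $\rho$), and let $$I(\zeta)=\frac{2\omega_1(i\zeta+\Omega(\zeta))}{c-1}+2\nu\big(\zeta_w(\rho)\,\omega_1-\zeta_w(\omega_1)\,\rho\big).$$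 **Theorem.** For every such $c,E$ the following hold. (a) The equation $\Omega^2(\zeta)=0$ has exactly four roots $\zeta_1,\zeta_2,\zeta_3,\zeta_4$ in $\mathbb{C}\setminus\{0\}$; they are purely imaginary and can be labelled so that $\operatorname{Im}\zeta_1<\operatorname{Im}\zeta_2<\operatorname{Im}\zeta_3<\operatorname{Im}\zeta_4$. For every $\zeta\in i\mathbb{R}$ with $\operatorname{Im}\zeta_1\le\operatorname{Im}\zeta\le\operatorname{Im}\zeta_2$ or $\operatorname{Im}\zeta_3\le\operatorname{Im}\zeta\le\operatorname{Im}\zeta_4$, and for either choice of $\Omega(\zeta)$, a number $\rho$ as above exists, and $\operatorname{Re}I(\zeta)=0$ for every such $\rho$. Moreover, for every non-lattice $\rho$ with the prescribed value of $\wp(\rho)$, whatever its sign, $$\operatorname{Re}\Big[\frac{2\omega_1(i\zeta+\Omega(\zeta))}{c-1}+\frac{4X(\zeta)}{\wp'(\rho)}\big(\zeta_w(\rho)\,\omega_1-\zeta_w(\omega_1)\,\rho\big)\Big]=0 .$$ (b) For every wave profile $f$ with parameters $c,E$, the segment $[-\lambda_2,\lambda_2]$ of the imaginary axis is contained in $\sigma_{\mathcal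 L}$, where $$\lambda_2=i\sqrt{\frac{(1-c^2)(-E)}{2}}\ \text{ if } c^2<1,\qquad \lambda_2=i\sqrt{\frac{(c^2-1)(E-2)}{2}}\ \text{ if } c^2>1 .$$ -/

import Mathlib

noncomputable section

namespace SineGordon

/-- Parameters of a rotational travelling wave: wave speed `c`, total energy `E`; subluminal
(`c ^ 2 < 1`, `E < 0`) or superluminal (`1 < c ^ 2`, `2 < E`). -/
def IsRotational (c E : ℝ) : Prop := (c ^ 2 < 1 ∧ E < 0) ∨ (1 < c ^ 2 ∧ 2 < E)

/-- `f` is the profile of a travelling wave `u(x,t) = f(x - c t)` of `u_tt - u_xx + sin u = 0`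
with total energy `E`. -/
structure IsStationary (c E : ℝ) (f : ℝ → ℝ) : Prop where
  contDiff : ContDiff ℝ 2 f
  pendulum : ∀ z, (c ^ 2 - 1) * deriv (deriv f) z + Real.sin (f z) = 0
  energy : ∀ z, 1 / 2 * (c ^ 2 - 1) * deriv f z ^ 2 + 1 - Real.cos (f z) = E

/-- The stability spectrum: those `lam` for which `lam W = 𝓛 W`, where
`𝓛 = !![0, 1; -(c² - 1) ∂² - cos f, 2 c ∂]`, has a nontrivial solution `W = (W₁, W₂)` bounded
on the whole line. -/
def stabilitySpectrum (c : ℝ) (f : ℝ → ℝ) : Set ℂ :=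
  {lam | ∃ W₁ W₂ : ℝ → ℂ, ContDiff ℝ 2 W₁ ∧ ContDiff ℝ 1 W₂ ∧
    (∃ z, W₁ z ≠ 0 ∨ W₂ z ≠ 0) ∧ (∃ M : ℝ, ∀ z, ‖W₁ z‖ ≤ M ∧ ‖W₂ z‖ ≤ M) ∧
    (∀ z, lam * W₁ z = W₂ z) ∧
    ∀ z, lam * W₂ z = -((c : ℂ) ^ 2 - 1) * deriv (deriv W₁) z - (Real.cos (f z) : ℂ) * W₁ z
      + 2 * (c : ℂ) * deriv W₂ z}

/-- The complete elliptic integral of the first kind, as a function of the modulus `k`. -/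
def ellipticK (k : ℝ) : ℝ :=
  ∫ y in (0 : ℝ)..(Real.pi / 2), 1 / Real.sqrt (1 - k ^ 2 * Real.sin y ^ 2)

/-- The elliptic modulus `k` of a rotational wave. -/
def modulus (c E : ℝ) : ℝ :=
  if c ^ 2 < 1 then Real.sqrt (2 / (2 - E)) else Real.sqrt (2 / E)

/-- The scaling parameter `λ` in `cos (f z) = α + β sn² (λ z, k)` for a rotational wave. -/
def scale (c E : ℝ) : ℝ :=
  if c ^ 2 < 1 then Real.sqrt ((2 - E) / (2 * (1 - c ^ 2)))
  else Real.sqrt (E / (2 * (c ^ 2 - 1)))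

/-- The real half-period `ω₁ = K(k) / λ`. -/
def omega1 (c E : ℝ) : ℝ := ellipticK (modulus c E) / scale c E

/-- The imaginary half-period is `ω₃ = i K'(k) / λ`, where `K'(k) = K(√(1 - k²))`;
this is `ω₃ / i`. -/
def omega3Im (c E : ℝ) : ℝ := ellipticK (Real.sqrt (1 - modulus c E ^ 2)) / scale c E

theorem ellipticK_pos {k : ℝ} (hk : k ^ 2 < 1) : 0 < ellipticK k := by
  have hpos : ∀ y : ℝ, 0 < 1 - k ^ 2 * Real.sin y ^ 2 := by
    intro y
    nlinarith [Real.sin_sq_le_one y, sq_nonneg k, sq_nonneg (Real.sin y)]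
  have hcont : Continuous fun y : ℝ => 1 / Real.sqrt (1 - k ^ 2 * Real.sin y ^ 2) := by
    refine continuous_const.div (by fun_prop) fun y => ?_
    exact (Real.sqrt_pos.2 (hpos y)).ne'
  refine intervalIntegral.intervalIntegral_pos_of_pos_on
    (hcont.intervalIntegrable _ _) (fun y _ => ?_) (by positivity)
  exact one_div_pos.2 (Real.sqrt_pos.2 (hpos y))

theorem IsRotational.modulus_sq {c E : ℝ} (h : IsRotational c E) :
    0 < modulus c E ^ 2 ∧ modulus c E ^ 2 < 1 := by
  rcases h with ⟨hc, hE⟩ | ⟨hc, hE⟩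
  · have h2 : 0 < 2 - E := by linarith
    rw [modulus, if_pos hc, Real.sq_sqrt (by positivity)]
    exact ⟨by positivity, by rw [div_lt_one h2]; linarith⟩
  · have h2 : 0 < E := by linarith
    rw [modulus, if_neg (by linarith), Real.sq_sqrt (by positivity)]
    exact ⟨by positivity, by rw [div_lt_one h2]; linarith⟩

theorem IsRotational.scale_pos {c E : ℝ} (h : IsRotational c E) : 0 < scale c E := by
  rcases h with ⟨hc, hE⟩ | ⟨hc, hE⟩
  · rw [scale, if_pos hc]
    exact Real.sqrt_pos.2 (div_pos (by linarith) (by linarith))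
  · rw [scale, if_neg (by linarith)]
    exact Real.sqrt_pos.2 (div_pos (by linarith) (by linarith))

theorem IsRotational.omega1_pos {c E : ℝ} (h : IsRotational c E) : 0 < omega1 c E :=
  div_pos (ellipticK_pos h.modulus_sq.2) h.scale_pos

theorem IsRotational.omega3Im_pos {c E : ℝ} (h : IsRotational c E) : 0 < omega3Im c E := by
  refine div_pos (ellipticK_pos ?_) h.scale_pos
  have := h.modulus_sq
  rw [Real.sq_sqrt (by linarith)]
  linarith

/-- The period pair `(2 ω₁, 2 ω₃)` of the Weierstrass functions attached to a rotational wave. -/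
def periods {c E : ℝ} (h : IsRotational c E) : PeriodPair where
  ω₁ := 2 * (omega1 c E : ℂ)
  ω₂ := 2 * (omega3Im c E : ℂ) * Complex.I
  indep := by
    have h1 := h.omega1_pos
    have h3 := h.omega3Im_pos
    rw [LinearIndependent.pair_iff]
    intro s t hst
    have hre := congrArg Complex.re hst
    have him := congrArg Complex.im hst
    simp at hre him
    exact ⟨hre.resolve_right h1.ne', him.resolve_right h3.ne'⟩

/-- The Weierstrass zeta function `1/z + ∑_{l ≠ 0} (1/(z - l) + 1/l + z/l²)` of a lattice.
(Since `1 / 0 = 0`, the term `l = 0` is `1/z`.) -/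
def weierstrassZeta (L : PeriodPair) (z : ℂ) : ℂ :=
  ∑' l : L.lattice, (1 / (z - l) + 1 / (l : ℂ) + z / (l : ℂ) ^ 2)

/-- `Ω²` as a function of the Lax parameter `ζ`. -/
def OmegaSq (c E : ℝ) (ζ : ℂ) : ℂ :=
  1 / 64 * (-8 * ((c : ℂ) ^ 2 - 1) * ((E : ℂ) - 1) - ((c : ℂ) - 1) ^ 2 / ζ ^ 2
    - 16 * ((c : ℂ) + 1) ^ 2 * ζ ^ 2)

def C4 (c E : ℝ) (ζ Ω : ℂ) : ℂ :=
  8 / 3 * ζ * (((c : ℂ) - 1) * ((E : ℂ) - 1) + 12 * ((c : ℂ) + 1) * ζ ^ 2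
    - 24 * Complex.I * ζ * Ω)

def C5 (c : ℝ) (ζ : ℂ) : ℂ := 16 * ((c : ℂ) - 1) ^ 2 * ((c : ℂ) + 1) * ζ

/-- The quantity `X` with `℘'(ρ)² = 4 X²`. -/
def halfDerivP (c E : ℝ) (ζ Ω : ℂ) : ℂ :=
  ζ * (-Complex.I * ((c : ℂ) - 1) * ((E : ℂ) - 1) - 4 * Complex.I * ((c : ℂ) + 1) * ζ ^ 2
    - 8 * ζ * Ω) / (((c : ℂ) - 1) ^ 3 * ((c : ℂ) + 1))

/-- `w` lies in the half-plane `-π/2 < arg w ≤ π/2`. -/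
def PrincipalArg (w : ℂ) : Prop := -(Real.pi / 2) < w.arg ∧ w.arg ≤ Real.pi / 2

open Classical in
/-- The sign `ν`. -/
def nu (c E : ℝ) (ζ Ω : ℂ) : ℂ := if PrincipalArg (halfDerivP c E ζ Ω) then 1 else -1

/-- `ρ` is a value of `℘⁻¹(-C₄/C₅)`. -/
def IsRho {c E : ℝ} (h : IsRotational c E) (ζ Ω ρ : ℂ) : Prop :=
  ρ ∉ (periods h).lattice ∧ (periods h).weierstrassP ρ = -C4 c E ζ Ω / C5 c ζ

/-- The value at `ζ`, for the square root `Ω` of `Ω²(ζ)` and the value `ρ` of `℘⁻¹(-C₄/C₅)`, of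
the integral over a period before `℘'(ρ)` is eliminated; the sign of `ρ` does not matter here. -/
def periodIntegral {c E : ℝ} (h : IsRotational c E) (ζ Ω ρ : ℂ) : ℂ :=
  2 * (omega1 c E : ℂ) * (Complex.I * ζ + Ω) / ((c : ℂ) - 1)
    + 4 * halfDerivP c E ζ Ω / (periods h).derivWeierstrassP ρ *
      (weierstrassZeta (periods h) ρ * (omega1 c E : ℂ)
        - weierstrassZeta (periods h) (omega1 c E : ℂ) * ρ)

/-- `I(ζ)`, for the square root `Ω` of `Ω²(ζ)` and the value `ρ` of `℘⁻¹(-C₄/C₅)`. -/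
def bigI {c E : ℝ} (h : IsRotational c E) (ζ Ω ρ : ℂ) : ℂ :=
  2 * (omega1 c E : ℂ) * (Complex.I * ζ + Ω) / ((c : ℂ) - 1)
    + 2 * nu c E ζ Ω *
      (weierstrassZeta (periods h) ρ * (omega1 c E : ℂ)
        - weierstrassZeta (periods h) (omega1 c E : ℂ) * ρ)

/-- The modulus `|λ₂|` of the end point `λ₂ = i |λ₂|`. -/
def lambda2 (c E : ℝ) : ℝ :=
  if c ^ 2 < 1 then Real.sqrt ((1 - c ^ 2) * (-E) / 2)
  else Real.sqrt ((c ^ 2 - 1) * (E - 2) / 2)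

end SineGordon

end

/-! Part (a). On a band ζ = iτ and Ω = iw with τ, w real. The prescribed value of ℘(ρ) forces ℘'(ρ)²
= (2X)² (`derivWeierstrassP_rho_sq`). The integral containing X/℘'(ρ) is even in ρ, so one may take
℘'(ρ) = 2X. The lattice is rectangular, so conj ρ gives the conjugate point of the same cubic. The
chord through the two points has half-slope -2τ/(c-1), and the addition theorem turns this into ℘(ρ
+ conj ρ) = ℘(ω₁) (`rho_add_conj_generic`; where w = 0 the tangent replaces the chord,
`rho_add_conj_endpoint`). Hence 2 Re ρ is an odd multiple of ω₁, and at such points x the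
combination ζ_w(x)ω₁ - ζ_w(ω₁)x vanishes (`zeta_combination_eq_zero`). In I + conj I the addition
theorem for ζ_w leaves only the half-slope, which cancels the contribution -4ω₁τ/(c-1) of iζ. The
sign ν reproduces the factor 2X/℘'(ρ) for the normalised ρ (`bigI_eq_periodIntegral`).

All this needs the invariants of a lattice given through K(k). For a rectangular lattice,
integrating ℘'² = 4(℘-e₁)(℘-e₂)(℘-e₃) along both axes expresses the half-periods by complete
elliptic integrals of a modulus and a scale built from the eⱼ. The half-periods determine modulus
and scale, so these are the given k and s, and the eⱼ follow (`IsRectangular.values_of_modulus`).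

Part (b) is independent of (a). For λ = it an exponential factor of modulus one reduces the spectral
problem to Hill's equation y'' = Qy, for which cos f + a, with a = E-1-2t²/(c²-1), is a product of
two solutions. If |a| > 1 this product has no zero, and √F exp(iκ∫1/F), with F its absolute value,
is a bounded solution. At the end points a = ∓1 the solutions sin(f/2) and cos(f/2) serve instead.
-/

noncomputable section

namespace SineGordon

open PeriodPair Filter Topology ComplexConjugate

/-! ### Weierstrass zeta function and the differential equation of ℘ -/

section Weierstrass

variable (L : PeriodPair)

/-- The Weierstrass zeta function without its pole at the origin. -/
def zetaExcept (z : ℂ) : ℂ :=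
  ∑' l : L.lattice, if l.1 = 0 then 0 else (1 / (z - l) + 1 / (l : ℂ) + z / (l : ℂ) ^ 2)

/-- The three terms combine to s²/((s-l)l²), of order |l|⁻³, which is summable over a lattice of
rank two. -/
theorem zeta_summand_bound {r : ℝ} (hr : 0 < r) {s l : ℂ} (hs : ‖s‖ < r) (h : 2 * r ≤ ‖l‖) :
    ‖1 / (s - l) + 1 / l + s / l ^ 2‖ ≤ 2 * r ^ 2 * ‖l‖ ^ (-3 : ℝ) := by
  have hl : 0 < ‖l‖ := by linarith
  have hl0 : l ≠ 0 := norm_pos_iff.1 hl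
  have hsl : ‖l‖ / 2 ≤ ‖s - l‖ := by
    rw [norm_sub_rev]
    exact .trans (by linarith) (norm_sub_norm_le l s)
  have hsl0 : s - l ≠ 0 := norm_pos_iff.1 (by linarith)
  have e : 1 / (s - l) + 1 / l + s / l ^ 2 = s ^ 2 / ((s - l) * l ^ 2) := by
    field_simp
    ring
  rw [e, norm_div, norm_mul, norm_pow, norm_pow]
  calc ‖s‖ ^ 2 / (‖s - l‖ * ‖l‖ ^ 2) ≤ r ^ 2 / (‖l‖ / 2 * ‖l‖ ^ 2) := by gcongr
    _ = 2 * r ^ 2 / ‖l‖ ^ 3 := by field_simp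
    _ = _ := by norm_cast

theorem hasSumLocallyUniformly_zetaExcept :
    HasSumLocallyUniformly (fun (l : L.lattice) (z : ℂ) =>
      if l.1 = 0 then 0 else (1 / (z - l) + 1 / (l : ℂ) + z / (l : ℂ) ^ 2)) (zetaExcept L) := by
  refine L.hasSumLocallyUniformly_aux (u := fun r l => 2 * r ^ 2 * ‖l‖ ^ (-3 : ℝ)) _
    (fun _ _ => (ZLattice.summable_norm_rpow _ _ (by simp; norm_num)).mul_left _) fun r hr =>
    Filter.eventually_atTop.mpr ⟨2 * r, ?_⟩
  rintro _ h s hs l rfl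
  split_ifs
  · simpa using! show 0 ≤ 2 * r ^ 2 * (‖l.1‖ ^ 3)⁻¹ by positivity
  · exact zeta_summand_bound hr hs h

/-- Termwise differentiation: by locally uniform convergence the derivatives of the partial sums
tend to the derivative of the limit, and they are the negated partial sums of the series for ℘
without its pole. -/
theorem hasDerivAt_zetaExcept {z : ℂ} (hz : z ∈ ((L.lattice : Set ℂ) \ {0})ᶜ) :
    HasDerivAt (zetaExcept L) (-L.weierstrassPExcept 0 z) z := by
  have hd : ∀ i : L.lattice, ∀ x ∈ ((L.lattice : Set ℂ) \ {0})ᶜ, HasDerivAt (fun z : ℂ =>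
      if i.1 = 0 then 0 else (1 / (z - i) + 1 / (i : ℂ) + z / (i : ℂ) ^ 2))
      (-(if i.1 = 0 then 0 else (1 / (x - i) ^ 2 - 1 / (i : ℂ) ^ 2))) x := by
    intro i x hx
    split_ifs with h0
    · simpa using hasDerivAt_const x (0 : ℂ)
    · have h1 : x - i ≠ 0 := by
        intro e
        obtain rfl := sub_eq_zero.mp e
        exact hx ⟨i.2, h0⟩
      have := ((((hasDerivAt_id x).sub_const (i : ℂ)).inv h1).add_const (1 / (i : ℂ))).add
        ((hasDerivAt_id x).div_const ((i : ℂ) ^ 2))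
      refine (this.congr_deriv ?_).congr_of_eventuallyEq (.of_forall fun z => ?_)
      · simp only [id]; ring
      · simp
  have hu := (hasSumLocallyUniformly_zetaExcept L).hasSumLocallyUniformlyOn
    (s := ((L.lattice : Set ℂ) \ {0})ᶜ)
  have hopen := L.isOpen_compl_lattice_sdiff (s := {0})
  have hF : ∀ᶠ s : Finset L.lattice in atTop, DifferentiableOn ℂ (fun z => ∑ i ∈ s,
      if i.1 = 0 then 0 else (1 / (z - i) + 1 / (i : ℂ) + z / (i : ℂ) ^ 2))
      ((L.lattice : Set ℂ) \ {0})ᶜ :=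
    .of_forall fun s => .fun_sum fun i _ x hx => (hd i x hx).differentiableAt.differentiableWithinAt
  have hdiff : DifferentiableOn ℂ (zetaExcept L) ((L.lattice : Set ℂ) \ {0})ᶜ :=
    hu.differentiableOn hF hopen
  have hderiv := ((hasSumLocallyUniformly_zetaExcept L).tendstoLocallyUniformlyOn
    (s := ((L.lattice : Set ℂ) \ {0})ᶜ)).deriv hF hopen
  have h1 := hderiv.tendsto_at hz
  have h2 : Tendsto (fun s : Finset L.lattice => ∑ i ∈ s,
      (-(if i.1 = 0 then 0 else (1 / (z - i) ^ 2 - 1 / (i : ℂ) ^ 2)))) atTop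
      (𝓝 (-L.weierstrassPExcept 0 z)) := (L.hasSum_weierstrassPExcept 0 z).neg
  have h3 := tendsto_nhds_unique h1 (h2.congr fun s => by
    simp only [Function.comp_apply]
    exact ((HasDerivAt.fun_sum fun i _ => hd i z hz).deriv).symm)
  rw [← h3]
  exact (hdiff.differentiableAt (hopen.mem_nhds hz)).hasDerivAt

theorem zetaExcept_zero : zetaExcept L 0 = 0 := by
  rw [zetaExcept, ← tsum_zero (α := ℂ) (β := L.lattice)]
  congr with l
  simp

theorem weierstrassZeta_eq (z : ℂ) : weierstrassZeta L z = 1 / z + zetaExcept L z := by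
  have h0 : Summable fun l : L.lattice => if l = 0 then 1 / z else 0 :=
    (hasSum_ite_eq (0 : L.lattice) (1 / z)).summable
  have h1 : ∑' l : L.lattice, (if l = 0 then 1 / z else 0) = 1 / z := by simp
  rw [← h1, zetaExcept, ← h0.tsum_add ((hasSumLocallyUniformly_zetaExcept L).hasSum).summable,
    weierstrassZeta]
  congr with l
  rcases eq_or_ne l 0 with rfl | hl
  · simp
  · simp [hl]

theorem ne_zero_of_notMem {z : ℂ} (hz : z ∉ L.lattice) : z ≠ 0 := by
  rintro rfl
  exact hz (zero_mem _)

theorem weierstrassP_eq_except (z : ℂ) :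
    L.weierstrassP z = 1 / z ^ 2 + L.weierstrassPExcept 0 z := by
  have := L.weierstrassPExcept_add 0 z
  simp only [ZeroMemClass.coe_zero, sub_zero] at this
  rw [← this]
  simp [add_comm]

theorem derivWeierstrassP_eq_except (z : ℂ) :
    L.derivWeierstrassP z = -2 / z ^ 3 + L.derivWeierstrassPExcept 0 z := by
  have := L.derivWeierstrassPExcept_sub 0 z
  simp only [ZeroMemClass.coe_zero, sub_zero] at this
  rw [← this]
  ring

theorem hasDerivAt_weierstrassZeta {z : ℂ} (hz : z ∉ L.lattice) :
    HasDerivAt (weierstrassZeta L) (-L.weierstrassP z) z := by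
  have h0 := ne_zero_of_notMem L hz
  have h := (hasDerivAt_inv h0).add (hasDerivAt_zetaExcept L (z := z) fun h => hz h.1)
  have e : weierstrassZeta L = (fun z => z⁻¹) + zetaExcept L := by
    ext w
    simp [weierstrassZeta_eq]
  rw [e]
  refine h.congr_deriv ?_
  rw [weierstrassP_eq_except]
  ring

theorem isOpen_compl_lattice : IsOpen ((L.lattice : Set ℂ)ᶜ) := L.isClosed_lattice.isOpen_compl

theorem countable_lattice : (L.lattice : Set ℂ).Countable :=
  countable_of_Lindelof_of_discrete (X := L.lattice)

theorem isPreconnected_compl_of_countable {s : Set ℂ} (hs : s.Countable) : IsPreconnected sᶜ :=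
  (hs.isConnected_compl_of_one_lt_rank (by simp)).isPreconnected

theorem isPreconnected_compl_lattice : IsPreconnected ((L.lattice : Set ℂ)ᶜ) :=
  isPreconnected_compl_of_countable (countable_lattice L)

theorem hasDerivAt_weierstrassP {z : ℂ} (hz : z ∉ L.lattice) :
    HasDerivAt L.weierstrassP (L.derivWeierstrassP z) z := by
  rw [← L.deriv_weierstrassP]
  exact (L.analyticOnNhd_weierstrassP z hz).differentiableAt.hasDerivAt

theorem weierstrassZeta_neg (z : ℂ) : weierstrassZeta L (-z) = -weierstrassZeta L z := by
  rw [weierstrassZeta, weierstrassZeta, ← (Equiv.neg L.lattice).tsum_eq, ← tsum_neg]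
  congr with l
  simp only [Equiv.neg_apply, NegMemClass.coe_neg]
  rw [show -z - -(l : ℂ) = -(z - l) by ring]
  simp only [one_div, inv_neg, even_two, Even.neg_pow]
  ring

/-- The quasi-periods of the Weierstrass zeta function. -/
theorem exists_quasiPeriod (l : L.lattice) :
    ∃ η : ℂ, ∀ z ∉ L.lattice, weierstrassZeta L (z + l) = weierstrassZeta L z + η := by
  have hmem : ∀ z : ℂ, z + l ∈ L.lattice ↔ z ∈ L.lattice := fun z =>
    L.lattice.toAddSubgroup.add_mem_cancel_right (y := z) l.2
  have hd : ∀ z ∉ L.lattice,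
      HasDerivAt (fun z => weierstrassZeta L (z + l) - weierstrassZeta L z) 0 z := by
    intro z hz
    have h1 := (hasDerivAt_weierstrassZeta L (z := z + l) (by rwa [hmem])).comp_add_const z (l : ℂ)
    refine (h1.sub (hasDerivAt_weierstrassZeta L hz)).congr_deriv ?_
    rw [L.weierstrassP_add_coe]
    ring
  -- The complement of a countable set in the plane is connected, so a single constant η serves for
  -- all z.
  obtain ⟨η, hη⟩ := (isOpen_compl_lattice L).exists_is_const_of_deriv_eq_zero
    (isPreconnected_compl_lattice L)
    (fun z hz => (hd z hz).differentiableAt.differentiableWithinAt) (fun z hz => (hd z hz).deriv)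
  exact ⟨η, fun z hz => by rw [← hη z hz]; ring⟩

theorem tendsto_weierstrassP_cobounded {l : ℂ} (hl : l ∈ L.lattice) :
    Tendsto L.weierstrassP (𝓝[≠] l) (Bornology.cobounded ℂ) := by
  apply tendsto_cobounded_of_meromorphicOrderAt_neg
  rw [L.order_weierstrassP l hl]
  decide

theorem not_eventually_derivWeierstrassP_eq_zero :
    ¬ Set.EqOn L.derivWeierstrassP 0 (L.lattice : Set ℂ)ᶜ := by
  intro h
  obtain ⟨a, ha⟩ := (isOpen_compl_lattice L).exists_is_const_of_deriv_eq_zero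
    (isPreconnected_compl_lattice L) L.differentiableOn_weierstrassP
    (by rw [L.deriv_weierstrassP]; exact h)
  have h1 := tendsto_weierstrassP_cobounded L (zero_mem _)
  have h2 : Tendsto L.weierstrassP (𝓝[≠] 0) (𝓝 a) := by
    refine tendsto_const_nhds.congr' ?_
    filter_upwards [self_mem_nhdsWithin, mem_nhdsWithin_of_mem_nhds
      (L.compl_lattice_sdiff_singleton_mem_nhds 0)] with w hw hw'
    exact (ha w fun h => hw' ⟨h, hw⟩).symm
  exact h2.not_tendsto (Metric.disjoint_nhds_cobounded a) h1

/-- Differentiating ℘'² = 4℘³ - g₂℘ - g₃ gives the claim multiplied by ℘'. The factor cancels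
because analytic functions on a connected set have no zero divisors and ℘' is not identically zero.
-/
theorem hasDerivAt_derivWeierstrassP {z : ℂ} (hz : z ∉ L.lattice) :
    HasDerivAt L.derivWeierstrassP (6 * L.weierstrassP z ^ 2 - L.g₂ / 2) z := by
  have hA := L.analyticOnNhd_weierstrassP
  have hB := L.analyticOnNhd_derivWeierstrassP
  have hC : AnalyticOnNhd ℂ
      (fun z => 2 * deriv L.derivWeierstrassP z - (12 * L.weierstrassP z ^ 2 - L.g₂))
      (L.lattice : Set ℂ)ᶜ := by
    intro x hx
    have h1 := (hB x hx).deriv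
    have h2 := hA x hx
    fun_prop
  have key := hB.eq_zero_or_eq_zero_of_mul_eq_zero hC (fun x hx => by
    have h1 := (hB x hx).differentiableAt.hasDerivAt.pow 2
    have h2 := ((((hasDerivAt_weierstrassP L hx).pow 3).const_mul 4).sub
      ((hasDerivAt_weierstrassP L hx).const_mul L.g₂)).sub_const L.g₃
    have h3 : L.derivWeierstrassP ^ 2 =ᶠ[𝓝 x]
        fun z => 4 * L.weierstrassP z ^ 3 - L.g₂ * L.weierstrassP z - L.g₃ := by
      filter_upwards [(isOpen_compl_lattice L).mem_nhds hx] with y hy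
      exact L.derivWeierstrassP_sq y hy
    have h4 := (h1.congr_of_eventuallyEq h3.symm).unique h2
    simp only [Nat.cast_ofNat, Nat.add_one_sub_one, pow_one] at h4
    linear_combination h4) (isPreconnected_compl_lattice L)
  rcases key with h | h
  · exact absurd h (not_eventually_derivWeierstrassP_eq_zero L)
  · have h1 := (hB z hz).differentiableAt.hasDerivAt
    refine h1.congr_deriv ?_
    have h2 := h z hz
    linear_combination (1 / 2 : ℂ) * h2

end Weierstrass

/-! ### Fibres, critical points and surjectivity of ℘ -/

section Addition

variable (L : PeriodPair)

theorem eventually_notMem_lattice {z : ℂ} (hz : z ∉ L.lattice) : ∀ᶠ w in 𝓝 z, w ∉ L.lattice :=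
  (isOpen_compl_lattice L).mem_nhds hz

theorem eventually_punctured_notMem_lattice : ∀ᶠ w in 𝓝[≠] (0 : ℂ), w ∉ L.lattice := by
  filter_upwards [self_mem_nhdsWithin, mem_nhdsWithin_of_mem_nhds
    (L.compl_lattice_sdiff_singleton_mem_nhds 0)] with w hw hw' h
  exact hw' ⟨h, hw⟩

/-- A period of `℘` on a punctured neighbourhood of the origin lies in the lattice. -/
theorem mem_lattice_of_eventually_eq {w : ℂ}
    (h : ∀ᶠ z in 𝓝[≠] (0 : ℂ), L.weierstrassP (w + z) = L.weierstrassP z) : w ∈ L.lattice := by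
  by_contra hw
  have h1 : Tendsto (fun z => L.weierstrassP (w + z)) (𝓝[≠] 0) (𝓝 (L.weierstrassP w)) := by
    have hc : ContinuousAt (fun z => L.weierstrassP (w + z)) 0 :=
      ContinuousAt.comp (g := L.weierstrassP) (f := fun z => w + z)
        (by simpa using (hasDerivAt_weierstrassP L hw).continuousAt) (by fun_prop)
    have := hc.tendsto.mono_left (nhdsWithin_le_nhds (s := {0}ᶜ))
    simpa using this
  exact (h1.congr' h).not_tendsto (Metric.disjoint_nhds_cobounded _)
    (tendsto_weierstrassP_cobounded L (zero_mem _))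

theorem hasDerivAt_weierstrassP_line {a : ℂ} {t : ℝ} (h : a + t ∉ L.lattice) :
    HasDerivAt (fun t : ℝ => (L.weierstrassP (a + t), L.derivWeierstrassP (a + t)))
      (L.derivWeierstrassP (a + t), 6 * L.weierstrassP (a + t) ^ 2 - L.g₂ / 2) t := by
  have h1 := ((hasDerivAt_weierstrassP L h).comp_const_add a (t : ℂ)).comp_ofReal
  have h2 := ((hasDerivAt_derivWeierstrassP L h).comp_const_add a (t : ℂ)).comp_ofReal
  exact h1.prodMk h2

/-- Along the real direction (℘, ℘') solves the autonomous system p' = q, q' = 6p² - g₂/2, so equal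
initial values give equal solutions. -/
theorem eventually_real_eq {a b : ℂ} (ha : a ∉ L.lattice) (hb : b ∉ L.lattice)
    (h : L.weierstrassP a = L.weierstrassP b)
    (h' : L.derivWeierstrassP a = L.derivWeierstrassP b) :
    ∀ᶠ t : ℝ in 𝓝 0, L.weierstrassP (a + t) = L.weierstrassP (b + t) := by
  have hv : ContDiffAt ℝ 1 (fun p : ℂ × ℂ => (p.2, 6 * p.1 ^ 2 - L.g₂ / 2))
      (L.weierstrassP a, L.derivWeierstrassP a) := by fun_prop
  obtain ⟨K, s, hs, hK⟩ := hv.exists_lipschitzOnWith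
  have hsol : ∀ c : ℂ, c ∉ L.lattice → L.weierstrassP c = L.weierstrassP a →
      L.derivWeierstrassP c = L.derivWeierstrassP a →
      ∀ᶠ t : ℝ in 𝓝 0, HasDerivAt
        (fun t : ℝ => (L.weierstrassP (c + t), L.derivWeierstrassP (c + t)))
        (L.derivWeierstrassP (c + t), 6 * L.weierstrassP (c + t) ^ 2 - L.g₂ / 2) t ∧
        (L.weierstrassP (c + t), L.derivWeierstrassP (c + t)) ∈ s := by
    intro c hc h1 h2
    have hcont : Tendsto (fun t : ℝ => c + (t : ℂ)) (𝓝 0) (𝓝 c) := by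
      have : Continuous fun t : ℝ => c + (t : ℂ) := by fun_prop
      simpa using this.tendsto 0
    have hd := hasDerivAt_weierstrassP_line L (a := c) (t := 0) (by simpa using hc)
    have hcs := hd.continuousAt.tendsto
    simp only [Complex.ofReal_zero, add_zero, h1, h2] at hcs
    filter_upwards [hcont.eventually (eventually_notMem_lattice L hc), hcs.eventually hs]
      with t ht hts
    exact ⟨hasDerivAt_weierstrassP_line L ht, hts⟩
  have := ODE_solution_unique_of_eventually (t₀ := (0 : ℝ)) (K := K) (s := fun _ => s)
    (v := fun _ p => (p.2, 6 * p.1 ^ 2 - L.g₂ / 2)) (.of_forall fun _ => hK)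
    (hsol a ha rfl rfl) (hsol b hb h.symm h'.symm) (by simp [h, h'])
  filter_upwards [this] with t ht
  exact congrArg Prod.fst ht

/-- Equality on a real interval spreads by the identity theorem: the translates of ℘ by a and by b
agree off a countable set. So ℘ has period a - b, and the pole at 0 forces a - b into the lattice.
-/
theorem sub_mem_lattice_of_eq {a b : ℂ} (ha : a ∉ L.lattice) (hb : b ∉ L.lattice)
    (h : L.weierstrassP a = L.weierstrassP b)
    (h' : L.derivWeierstrassP a = L.derivWeierstrassP b) : a - b ∈ L.lattice := by
  set s : Set ℂ := {z | a + z ∈ L.lattice} ∪ {z | b + z ∈ L.lattice} with hs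
  have hcount : s.Countable :=
    ((countable_lattice L).preimage (add_right_injective a)).union
      ((countable_lattice L).preimage (add_right_injective b))
  have hmem : ∀ z, z ∈ sᶜ ↔ a + z ∉ L.lattice ∧ b + z ∉ L.lattice := fun z => by
    simp [hs]
  have han : AnalyticOnNhd ℂ (fun z => L.weierstrassP (a + z) - L.weierstrassP (b + z)) sᶜ := by
    intro z hz
    rw [hmem] at hz
    have h1 : AnalyticAt ℂ (fun z => L.weierstrassP (a + z)) z :=
      (L.analyticOnNhd_weierstrassP _ hz.1).comp (by fun_prop)
    have h2 : AnalyticAt ℂ (fun z => L.weierstrassP (b + z)) z :=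
      (L.analyticOnNhd_weierstrassP _ hz.2).comp (by fun_prop)
    exact h1.sub h2
  have ht : Tendsto (fun t : ℝ => (t : ℂ)) (𝓝[≠] 0) (𝓝[≠] 0) := by
    refine tendsto_nhdsWithin_iff.2 ⟨?_, ?_⟩
    · have : Tendsto (fun t : ℝ => (t : ℂ)) (𝓝 0) (𝓝 0) := by
        simpa using Complex.continuous_ofReal.tendsto 0
      exact this.mono_left nhdsWithin_le_nhds
    · filter_upwards [self_mem_nhdsWithin] with t ht
      simpa using ht
  have hfreq : ∃ᶠ z in 𝓝[≠] (0 : ℂ), L.weierstrassP (a + z) - L.weierstrassP (b + z) = 0 := by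
    have h1 : ∀ᶠ t : ℝ in 𝓝[≠] 0, L.weierstrassP (a + t) - L.weierstrassP (b + t) = 0 := by
      filter_upwards [mem_nhdsWithin_of_mem_nhds (eventually_real_eq L ha hb h h')] with t ht
      exact sub_eq_zero.2 ht
    exact ht.frequently h1.frequently
  have key := han.eqOn_zero_of_preconnected_of_frequently_eq_zero
    (isPreconnected_compl_of_countable hcount) ((hmem 0).2 (by simpa using ⟨ha, hb⟩)) hfreq
  by_contra hab
  refine hab (mem_lattice_of_eventually_eq L ?_)
  have hcont : Tendsto (fun z : ℂ => a - b + z) (𝓝[≠] 0) (𝓝 (a - b)) := by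
    have : Continuous fun z : ℂ => a - b + z := by fun_prop
    simpa using (this.tendsto 0).mono_left (nhdsWithin_le_nhds (s := {0}ᶜ))
  filter_upwards [hcont.eventually (eventually_notMem_lattice L hab),
    eventually_punctured_notMem_lattice L] with z h1 h2
  have := key (x := z - b)
    ((hmem _).2 ⟨by rwa [show a + (z - b) = a - b + z by ring], by simpa using h2⟩)
  have h3 : L.weierstrassP (a + (z - b)) - L.weierstrassP (b + (z - b)) = 0 := this
  rw [show a + (z - b) = a - b + z by ring, show b + (z - b) = z by ring] at h3
  exact sub_eq_zero.1 h3

theorem neg_notMem {z : ℂ} (hz : z ∉ L.lattice) : -z ∉ L.lattice := by simpa using hz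

theorem sub_mem_or_add_mem_of_eq {a b : ℂ} (ha : a ∉ L.lattice) (hb : b ∉ L.lattice)
    (h : L.weierstrassP a = L.weierstrassP b) : a - b ∈ L.lattice ∨ a + b ∈ L.lattice := by
  have h1 : L.derivWeierstrassP a ^ 2 = L.derivWeierstrassP b ^ 2 := by
    rw [L.derivWeierstrassP_sq a ha, L.derivWeierstrassP_sq b hb, h]
  rcases sq_eq_sq_iff_eq_or_eq_neg.1 h1 with h2 | h2
  · exact .inl (sub_mem_lattice_of_eq L ha hb h h2)
  · right
    have := sub_mem_lattice_of_eq L ha (neg_notMem L hb) (by rw [h, L.weierstrassP_neg])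
      (by rw [h2, L.derivWeierstrassP_neg])
    simpa using this

/-- At a zero of ℘' the points u and -u have the same ℘ and ℘', hence are congruent. Conversely, at
a half-period the odd function ℘' equals its own negative. -/
theorem derivWeierstrassP_eq_zero_iff {u : ℂ} (hu : u ∉ L.lattice) :
    L.derivWeierstrassP u = 0 ↔ 2 * u ∈ L.lattice := by
  constructor
  · intro h
    have := sub_mem_lattice_of_eq L hu (neg_notMem L hu) (by rw [L.weierstrassP_neg])
      (by rw [L.derivWeierstrassP_neg, h, neg_zero])
    rwa [sub_neg_eq_add, ← two_mul] at this
  · intro h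
    have := L.derivWeierstrassP_add_coe (-u) ⟨2 * u, h⟩
    simp only at this
    rw [show -u + 2 * u = u by ring, L.derivWeierstrassP_neg] at this
    exact CharZero.eq_neg_self_iff.1 this

/-- If ℘ omitted P, then 1/(℘ - P), set to 0 at the poles of ℘, would be entire and doubly periodic.
By Liouville it would be constantly 0, but it is nonzero off the lattice. -/
theorem exists_weierstrassP_eq (P : ℂ) : ∃ ρ ∉ L.lattice, L.weierstrassP ρ = P := by
  classical
  by_contra! hne
  set g : ℂ → ℂ := fun z => if z ∈ L.lattice then 0 else (L.weierstrassP z - P)⁻¹ with hg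
  have hper : ∀ z w, w ∈ L.lattice → g (z + w) = g z := by
    intro z w hw
    have hmem : z + w ∈ L.lattice ↔ z ∈ L.lattice :=
      L.lattice.toAddSubgroup.add_mem_cancel_right hw
    simp only [hg, hmem, L.weierstrassP_add_coe z ⟨w, hw⟩]
  have hoff : ∀ z ∉ L.lattice, DifferentiableAt ℂ g z := by
    intro z hz
    have h1 : DifferentiableAt ℂ (fun z => (L.weierstrassP z - P)⁻¹) z :=
      ((hasDerivAt_weierstrassP L hz).differentiableAt.sub_const P).inv
        (sub_ne_zero.2 (hne z hz))
    refine h1.congr_of_eventuallyEq ?_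
    filter_upwards [eventually_notMem_lattice L hz] with w hw
    simp [hg, hw]
  have h0 : DifferentiableAt ℂ g 0 := by
    refine (Complex.analyticAt_of_differentiable_on_punctured_nhds_of_continuousAt ?_
      ?_).differentiableAt
    · filter_upwards [eventually_punctured_notMem_lattice L] with z hz using hoff z hz
    · rw [continuousAt_iff_punctured_nhds]
      have h1 : Tendsto (fun z => (L.weierstrassP z - P)⁻¹) (𝓝[≠] 0) (𝓝 0) :=
        tendsto_inv₀_cobounded.comp
          ((tendsto_sub_const_cobounded P).comp
            (tendsto_weierstrassP_cobounded L (zero_mem _)))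
      have h2 : g 0 = 0 := by simp [hg]
      rw [h2]
      refine h1.congr' ?_
      filter_upwards [eventually_punctured_notMem_lattice L] with z hz
      simp [hg, hz]
  have hdiff : Differentiable ℂ g := by
    intro z
    by_cases hz : z ∈ L.lattice
    · have h1 : DifferentiableAt ℂ (fun x => g (x - z)) z :=
        DifferentiableAt.comp z (g := g) (f := fun x => x - z) (by simpa using h0) (by fun_prop)
      refine h1.congr_of_eventuallyEq (.of_forall fun x => ?_)
      have := hper (x - z) z hz
      simpa using this
    · exact hoff z hz
  have hb := (IsZLattice.isCompact_range_of_periodic L.lattice g hdiff.continuous hper).isBounded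
  have h1 := hdiff.apply_eq_apply_of_bounded hb (L.ω₁ / 2) 0
  have h2 := L.ω₁_div_two_notMem_lattice
  simp only [hg, h2, zero_mem, if_true, if_false] at h1
  exact sub_ne_zero.2 (hne _ h2) (inv_eq_zero.1 h1)

end Addition

/-! ### Addition and duplication theorems for ζ_w and ℘ -/

section Addition

variable (L : PeriodPair)

/-- Half the slope of the chord of the elliptic curve through the points with parameters
`z` and `u`. -/
def halfSlope (z u : ℂ) : ℂ :=
  (L.derivWeierstrassP z - L.derivWeierstrassP u) / (2 * (L.weierstrassP z - L.weierstrassP u))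

theorem weierstrassP_ne_of_notMem {z u : ℂ} (hz : z ∉ L.lattice) (hu : u ∉ L.lattice)
    (hzu : z + u ∉ L.lattice) (hne : z - u ∉ L.lattice) :
    L.weierstrassP z - L.weierstrassP u ≠ 0 := fun h =>
  (sub_mem_or_add_mem_of_eq L hz hu (sub_eq_zero.1 h)).elim hne hzu

/-- Differentiating the addition theorem of ζ_w in z with the help of this formula gives the one of
℘. -/
theorem hasDerivAt_halfSlope_left {z u : ℂ} (hz : z ∉ L.lattice) (hu : u ∉ L.lattice)
    (hzu : z + u ∉ L.lattice) (hne : z - u ∉ L.lattice) :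
    HasDerivAt (fun z => halfSlope L z u)
      (2 * L.weierstrassP z + L.weierstrassP u - halfSlope L z u ^ 2) z := by
  have hD := weierstrassP_ne_of_notMem L hz hu hzu hne
  have h1 := ((hasDerivAt_derivWeierstrassP L hz).sub_const (L.derivWeierstrassP u)).div
    (((hasDerivAt_weierstrassP L hz).sub_const (L.weierstrassP u)).const_mul 2)
    (mul_ne_zero two_ne_zero hD)
  refine h1.congr_deriv ?_
  have e1 := L.derivWeierstrassP_sq z hz
  have e2 := L.derivWeierstrassP_sq u hu
  rw [halfSlope]
  field_simp
  linear_combination (-1 : ℂ) * e1 + e2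

/-- The addition theorem with the sum s = z + u held fixed: its right-hand side does not depend on
how s is split, by the cubic equation at both points. -/
theorem hasDerivAt_halfSlope_add_zeta {s w : ℂ} (hs : s ∉ L.lattice) (hw : w ∉ L.lattice)
    (hsw : s - w ∉ L.lattice) (hne : s - 2 * w ∉ L.lattice) :
    HasDerivAt (fun w => halfSlope L (s - w) w + weierstrassZeta L (s - w) + weierstrassZeta L w)
      0 w := by
  have hD := weierstrassP_ne_of_notMem L hsw hw (by simpa using hs)
    (by rwa [show s - w - w = s - 2 * w by ring])
  have a1 := (hasDerivAt_derivWeierstrassP L hsw).comp_const_sub s w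
  have a2 := (hasDerivAt_weierstrassP L hsw).comp_const_sub s w
  have a3 := (hasDerivAt_weierstrassZeta L hsw).comp_const_sub s w
  have h1 := (((a1.sub (hasDerivAt_derivWeierstrassP L hw)).div
    ((a2.sub (hasDerivAt_weierstrassP L hw)).const_mul 2) (mul_ne_zero two_ne_zero hD)).add
    a3).add (hasDerivAt_weierstrassZeta L hw)
  refine h1.congr_deriv ?_
  have e1 := L.derivWeierstrassP_sq _ hsw
  have e2 := L.derivWeierstrassP_sq w hw
  simp only [Pi.sub_apply]
  field_simp
  linear_combination (2 : ℂ) * e1 - 2 * e2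

theorem tendsto_halfSlope_add_zeta {s : ℂ} (hs : s ∉ L.lattice) :
    Tendsto (fun w => halfSlope L (s - w) w + weierstrassZeta L (s - w) + weierstrassZeta L w)
      (𝓝[≠] 0) (𝓝 (weierstrassZeta L s)) := by
  have cs : ContinuousAt (fun w : ℂ => s - w) 0 := by fun_prop
  have c1 : ContinuousAt (fun w => L.weierstrassP (s - w)) 0 :=
    ContinuousAt.comp (g := L.weierstrassP)
      (by simpa using (hasDerivAt_weierstrassP L hs).continuousAt) cs
  have c2 : ContinuousAt (fun w => L.derivWeierstrassP (s - w)) 0 :=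
    ContinuousAt.comp (g := L.derivWeierstrassP)
      (by simpa using (hasDerivAt_derivWeierstrassP L hs).continuousAt) cs
  have c3 : ContinuousAt (fun w => weierstrassZeta L (s - w)) 0 :=
    ContinuousAt.comp (g := weierstrassZeta L)
      (by simpa using (hasDerivAt_weierstrassZeta L hs).continuousAt) cs
  have d1 := (L.analyticAt_weierstrassPExcept 0).continuousAt
  have d2 := (L.analyticAt_derivWeierstrassPExcept 0).continuousAt
  have d3 : ContinuousAt (zetaExcept L) 0 :=
    (hasDerivAt_zetaExcept L (z := 0) (by simp)).continuousAt
  -- The slope behaves like -1/w and ζ_w(w) like 1/w. Multiplying numerator and denominator of the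
  -- slope by w² cancels these poles explicitly; F is the resulting form, continuous at 0.
  set F : ℂ → ℂ := fun w =>
    (w ^ 2 * (L.derivWeierstrassP (s - w) - L.derivWeierstrassPExcept 0 w)
      + 2 * (w + w ^ 2 * zetaExcept L w) *
        (L.weierstrassP (s - w) - L.weierstrassPExcept 0 w) - 2 * zetaExcept L w) /
    (2 * (w ^ 2 * (L.weierstrassP (s - w) - L.weierstrassPExcept 0 w) - 1))
    + weierstrassZeta L (s - w) with hF
  have hFc : ContinuousAt F 0 := by
    refine ContinuousAt.add (ContinuousAt.div (by fun_prop) (by fun_prop) (by simp)) c3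
  have hF0 : F 0 = weierstrassZeta L s := by simp [hF, zetaExcept_zero]
  have hFt : Tendsto F (𝓝[≠] 0) (𝓝 (weierstrassZeta L s)) :=
    hF0 ▸ hFc.tendsto.mono_left nhdsWithin_le_nhds
  have hden : ∀ᶠ w in 𝓝[≠] (0 : ℂ),
      w ^ 2 * (L.weierstrassP (s - w) - L.weierstrassPExcept 0 w) - 1 ≠ 0 := by
    have hc : ContinuousAt
      (fun w => w ^ 2 * (L.weierstrassP (s - w) - L.weierstrassPExcept 0 w) - 1) 0 := by fun_prop
    exact mem_nhdsWithin_of_mem_nhds (hc.eventually_ne (by simp))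
  refine hFt.congr' ?_
  filter_upwards [self_mem_nhdsWithin, hden] with w (hw0 : w ≠ 0) hw
  simp only [hF]
  rw [halfSlope, weierstrassP_eq_except L w, derivWeierstrassP_eq_except L w,
    weierstrassZeta_eq L w]
  have e : 2 * (L.weierstrassP (s - w) - (1 / w ^ 2 + L.weierstrassPExcept 0 w)) =
      2 * (w ^ 2 * (L.weierstrassP (s - w) - L.weierstrassPExcept 0 w) - 1) / w ^ 2 := by
    field_simp
    ring
  rw [e]
  set A := w ^ 2 * (L.weierstrassP (s - w) - L.weierstrassPExcept 0 w) - 1 with hA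
  have hA' : L.weierstrassP (s - w) - L.weierstrassPExcept 0 w = (A + 1) / w ^ 2 := by
    rw [hA]
    field_simp
    ring
  rw [hA']
  field_simp
  ring

/-- The addition theorem of the Weierstrass zeta function. -/
theorem weierstrassZeta_add {z u : ℂ} (hz : z ∉ L.lattice) (hu : u ∉ L.lattice)
    (hzu : z + u ∉ L.lattice) (hne : z - u ∉ L.lattice) :
    weierstrassZeta L (z + u) =
      weierstrassZeta L z + weierstrassZeta L u + halfSlope L z u := by
  set s := z + u with hs
  -- Off this closed countable set the derivative computation is valid, and the complement is
  -- connected; the constant is then found by letting w tend to 0.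
  set B : Set ℂ := (L.lattice : Set ℂ) ∪ {w | s - w ∈ L.lattice} ∪ {w | s - 2 * w ∈ L.lattice}
    with hB
  have hmem : ∀ w, w ∈ Bᶜ ↔ w ∉ L.lattice ∧ s - w ∉ L.lattice ∧ s - 2 * w ∉ L.lattice := fun w => by
    simp [hB, and_assoc]
  have hcount : B.Countable :=
    ((countable_lattice L).union ((countable_lattice L).preimage (sub_right_injective))).union
      ((countable_lattice L).preimage (f := fun w => s - 2 * w) fun x y h => by
        simpa using h)
  have hclosed : IsClosed B :=
    (L.isClosed_lattice.union (L.isClosed_lattice.preimage (f := fun w => s - w)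
      (by fun_prop))).union (L.isClosed_lattice.preimage (f := fun w => s - 2 * w) (by fun_prop))
  have hder : ∀ w ∈ Bᶜ, HasDerivAt
      (fun w => halfSlope L (s - w) w + weierstrassZeta L (s - w) + weierstrassZeta L w) 0 w := by
    intro w hw
    rw [hmem] at hw
    exact hasDerivAt_halfSlope_add_zeta L hzu hw.1 hw.2.1 hw.2.2
  obtain ⟨a, ha⟩ := hclosed.isOpen_compl.exists_is_const_of_deriv_eq_zero
    (isPreconnected_compl_of_countable hcount)
    (fun w hw => (hder w hw).differentiableAt.differentiableWithinAt)
    (fun w hw => (hder w hw).deriv)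
  have hcs : ∀ c : ℂ, Tendsto (fun w : ℂ => s - c * w) (𝓝[≠] 0) (𝓝 s) := by
    intro c
    have : Continuous fun w : ℂ => s - c * w := by fun_prop
    simpa using (this.tendsto 0).mono_left (nhdsWithin_le_nhds (s := {0}ᶜ))
  have hlim : weierstrassZeta L s = a := by
    refine tendsto_nhds_unique (tendsto_halfSlope_add_zeta L hzu)
      (tendsto_const_nhds.congr' ?_)
    filter_upwards [eventually_punctured_notMem_lattice L,
      (hcs 1).eventually (eventually_notMem_lattice L hzu),
      (hcs 2).eventually (eventually_notMem_lattice L hzu)] with w h1 h2 h3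
    rw [one_mul] at h2
    exact (ha w ((hmem w).2 ⟨h1, h2, h3⟩)).symm
  have hval := ha u ((hmem u).2 ⟨hu, by simpa [hs] using hz, by
    rwa [hs, show z + u - 2 * u = z - u by ring]⟩)
  simp only [hs, add_sub_cancel_right] at hval
  rw [hlim, ← hval]
  ring

/-- The addition theorem of the Weierstrass `℘` function. -/
theorem weierstrassP_add {z u : ℂ} (hz : z ∉ L.lattice) (hu : u ∉ L.lattice)
    (hzu : z + u ∉ L.lattice) (hne : z - u ∉ L.lattice) :
    L.weierstrassP (z + u) =
      halfSlope L z u ^ 2 - L.weierstrassP z - L.weierstrassP u := by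
  have h1 := (hasDerivAt_weierstrassZeta L hzu).comp_add_const z u
  have h2 := ((hasDerivAt_weierstrassZeta L hz).add_const (weierstrassZeta L u)).add
    (hasDerivAt_halfSlope_left L hz hu hzu hne)
  have c1 : Tendsto (fun w : ℂ => w + u) (𝓝 z) (𝓝 (z + u)) :=
    (continuous_add_const u).tendsto z
  have c2 : Tendsto (fun w : ℂ => w - u) (𝓝 z) (𝓝 (z - u)) :=
    (continuous_sub_right u).tendsto z
  have h3 := h2.unique (h1.congr_of_eventuallyEq (by
    filter_upwards [eventually_notMem_lattice L hz,
      c1.eventually (eventually_notMem_lattice L hzu),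
      c2.eventually (eventually_notMem_lattice L hne)] with w w1 w2 w3
    exact (weierstrassZeta_add L w1 hu w2 w3).symm))
  linear_combination h3

/-- The chord tends to the tangent: the half-slope is half the quotient of the difference quotients
of ℘' and ℘. The duplication formulas are the limits of the addition theorems. -/
theorem tendsto_halfSlope_self {z : ℂ} (hz : z ∉ L.lattice) (h2z : 2 * z ∉ L.lattice) :
    Tendsto (fun w => halfSlope L w z) (𝓝[≠] z)
      (𝓝 ((6 * L.weierstrassP z ^ 2 - L.g₂ / 2) / (2 * L.derivWeierstrassP z))) := by
  have hne : L.derivWeierstrassP z ≠ 0 := fun h => h2z ((derivWeierstrassP_eq_zero_iff L hz).1 h)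
  have h1 := (hasDerivAt_iff_tendsto_slope.1 (hasDerivAt_derivWeierstrassP L hz)).div
    ((hasDerivAt_iff_tendsto_slope.1 (hasDerivAt_weierstrassP L hz)).const_mul 2)
    (mul_ne_zero two_ne_zero hne)
  refine h1.congr' ?_
  filter_upwards [self_mem_nhdsWithin] with w (hw : w ≠ z)
  have : w - z ≠ 0 := sub_ne_zero.2 hw
  simp only [Pi.div_apply, slope_def_field, halfSlope]
  rw [mul_div_assoc', div_div_div_cancel_right₀ this]

theorem eventually_duplication_conditions {z : ℂ} (hz : z ∉ L.lattice) (h2z : 2 * z ∉ L.lattice) :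
    ∀ᶠ w in 𝓝[≠] z, w ∉ L.lattice ∧ w + z ∉ L.lattice ∧ w - z ∉ L.lattice := by
  have c1 : Tendsto (fun w : ℂ => w + z) (𝓝[≠] z) (𝓝 (2 * z)) := by
    rw [two_mul]
    exact ((continuous_add_const z).tendsto z).mono_left nhdsWithin_le_nhds
  have c2 : Tendsto (fun w : ℂ => w - z) (𝓝[≠] z) (𝓝[≠] 0) := by
    refine tendsto_nhdsWithin_iff.2 ⟨?_, ?_⟩
    · simpa using ((continuous_sub_right z).tendsto z).mono_left (nhdsWithin_le_nhds (s := {z}ᶜ))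
    · filter_upwards [self_mem_nhdsWithin] with w (hw : w ≠ z)
      exact sub_ne_zero.2 hw
  filter_upwards [mem_nhdsWithin_of_mem_nhds (eventually_notMem_lattice L hz),
    c1.eventually (eventually_notMem_lattice L h2z),
    c2.eventually (eventually_punctured_notMem_lattice L)] with w h1 h2 h3 using ⟨h1, h2, h3⟩

theorem tendsto_add_self (z : ℂ) : Tendsto (fun w : ℂ => w + z) (𝓝[≠] z) (𝓝 (2 * z)) := by
  rw [two_mul]
  exact ((continuous_add_const z).tendsto z).mono_left nhdsWithin_le_nhds

/-- The duplication formula of the Weierstrass zeta function. -/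
theorem weierstrassZeta_two_mul {z : ℂ} (hz : z ∉ L.lattice) (h2z : 2 * z ∉ L.lattice) :
    weierstrassZeta L (2 * z) = 2 * weierstrassZeta L z
      + (6 * L.weierstrassP z ^ 2 - L.g₂ / 2) / (2 * L.derivWeierstrassP z) := by
  have h1 : Tendsto (fun w => weierstrassZeta L (w + z)) (𝓝[≠] z) (𝓝 (weierstrassZeta L (2 * z))) :=
    (hasDerivAt_weierstrassZeta L h2z).continuousAt.tendsto.comp (tendsto_add_self z)
  have h2 := (((hasDerivAt_weierstrassZeta L hz).continuousAt.tendsto.mono_left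
    (nhdsWithin_le_nhds (s := {z}ᶜ))).add_const (weierstrassZeta L z)).add
    (tendsto_halfSlope_self L hz h2z)
  rw [two_mul (weierstrassZeta L z)]
  refine tendsto_nhds_unique h1 (h2.congr' ?_)
  filter_upwards [eventually_duplication_conditions L hz h2z] with w hw
  exact (weierstrassZeta_add L hw.1 hz hw.2.1 hw.2.2).symm

/-- The duplication formula of the Weierstrass `℘` function. -/
theorem weierstrassP_two_mul {z : ℂ} (hz : z ∉ L.lattice) (h2z : 2 * z ∉ L.lattice) :
    L.weierstrassP (2 * z) =
      ((6 * L.weierstrassP z ^ 2 - L.g₂ / 2) / (2 * L.derivWeierstrassP z)) ^ 2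
        - 2 * L.weierstrassP z := by
  have h1 : Tendsto (fun w => L.weierstrassP (w + z)) (𝓝[≠] z) (𝓝 (L.weierstrassP (2 * z))) :=
    (hasDerivAt_weierstrassP L h2z).continuousAt.tendsto.comp (tendsto_add_self z)
  have h2 := (((tendsto_halfSlope_self L hz h2z).pow 2).sub
    ((hasDerivAt_weierstrassP L hz).continuousAt.tendsto.mono_left
    (nhdsWithin_le_nhds (s := {z}ᶜ)))).sub_const (L.weierstrassP z)
  rw [two_mul (L.weierstrassP z), ← sub_sub]
  refine tendsto_nhds_unique h1 (h2.congr' ?_)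
  filter_upwards [eventually_duplication_conditions L hz h2z] with w hw
  exact (weierstrassP_add L hw.1 hz hw.2.1 hw.2.2).symm

end Addition

/-! ### Half-periods as complete elliptic integrals -/

section RealElliptic

/-- A real solution of `p'² = 4 (p - e₁) (p - e₂) (p - e₃)` that decreases from a pole at `0` to the
critical value `e₁` at `a`. -/
structure IsDescent (a e₁ e₂ e₃ : ℝ) (p p' : ℝ → ℝ) : Prop where
  pos : 0 < a
  hasDerivAt : ∀ x ∈ Set.Ioc 0 a, HasDerivAt p (p' x) x
  sq : ∀ x ∈ Set.Ioc 0 a, p' x ^ 2 = 4 * (p x - e₁) * (p x - e₂) * (p x - e₃)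
  ne : ∀ x ∈ Set.Ioo 0 a, p' x ≠ 0
  tendsto_atTop : Tendsto p (𝓝[>] 0) atTop
  end_eq : p a = e₁

variable {a e₁ e₂ e₃ : ℝ} {p p' : ℝ → ℝ}

theorem IsDescent.continuousOn (h : IsDescent a e₁ e₂ e₃ p p') : ContinuousOn p (Set.Ioc 0 a) :=
  fun x hx => (h.hasDerivAt x hx).continuousAt.continuousWithinAt

theorem IsDescent.exists_gt (h : IsDescent a e₁ e₂ e₃ p p') (M : ℝ) :
    ∃ x ∈ Set.Ioo 0 a, M < p x := by
  have h1 : ∀ᶠ x in 𝓝[>] (0 : ℝ), x ∈ Set.Ioo 0 a := Ioo_mem_nhdsGT h.pos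
  obtain ⟨x, hx, hM⟩ := (h1.and (h.tendsto_atTop.eventually_gt_atTop M)).exists
  exact ⟨x, hx, hM⟩

/-- By Darboux a derivative without zeros has constant sign, and an increasing p could not come down
from +∞. -/
theorem IsDescent.deriv_neg (h : IsDescent a e₁ e₂ e₃ p p') : ∀ x ∈ Set.Ioo 0 a, p' x < 0 := by
  have hd : ∀ x ∈ Set.Ioo 0 a, HasDerivWithinAt p (p' x) (Set.Ioo 0 a) x := fun x hx =>
    (h.hasDerivAt x ⟨hx.1, hx.2.le⟩).hasDerivWithinAt
  rcases hasDerivWithinAt_forall_lt_or_forall_gt_of_forall_ne (convex_Ioo 0 a) hd h.ne with h1 | h1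
  · exact h1
  · exfalso
    have hmono : StrictMonoOn p (Set.Ioc 0 a) := by
      refine strictMonoOn_of_deriv_pos (convex_Ioc 0 a) h.continuousOn fun x hx => ?_
      rw [interior_Ioc] at hx
      rw [(h.hasDerivAt x ⟨hx.1, hx.2.le⟩).deriv]
      exact h1 x hx
    obtain ⟨x, hx, hM⟩ := h.exists_gt e₁
    have := hmono ⟨hx.1, hx.2.le⟩ ⟨h.pos, le_rfl⟩ hx.2
    rw [h.end_eq] at this
    linarith

theorem IsDescent.gt (h : IsDescent a e₁ e₂ e₃ p p') : ∀ x ∈ Set.Ioo 0 a, e₁ < p x := by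
  intro x hx
  have hanti : StrictAntiOn p (Set.Ioc 0 a) := by
    refine strictAntiOn_of_deriv_neg (convex_Ioc 0 a) h.continuousOn fun x hx => ?_
    rw [interior_Ioc] at hx
    rw [(h.hasDerivAt x ⟨hx.1, hx.2.le⟩).deriv]
    exact h.deriv_neg x hx
  have := hanti ⟨hx.1, hx.2.le⟩ ⟨h.pos, le_rfl⟩ hx.2
  rwa [h.end_eq] at this

theorem IsDescent.exists_eq (h : IsDescent a e₁ e₂ e₃ p p') {y : ℝ} (hy : e₁ < y) :
    ∃ x ∈ Set.Ioo 0 a, p x = y := by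
  obtain ⟨x, hx, hM⟩ := h.exists_gt y
  have hc : ContinuousOn p (Set.Icc x a) := h.continuousOn.mono fun z hz => ⟨hx.1.trans_le hz.1, hz.2⟩
  obtain ⟨z, hz, rfl⟩ := intermediate_value_Icc' hx.2.le hc ⟨by rw [h.end_eq]; exact hy.le, hM.le⟩
  refine ⟨z, ⟨hx.1.trans_le hz.1, lt_of_le_of_ne hz.2 ?_⟩, rfl⟩
  rintro rfl
  rw [h.end_eq] at hy
  exact lt_irrefl _ hy

/-- Every value above e₁ is taken on the open interval, where p' ≠ 0, whereas p' vanishes wherever p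
equals a root of the cubic. -/
theorem IsDescent.root_le (h : IsDescent a e₁ e₂ e₃ p p') : e₂ ≤ e₁ ∧ e₃ ≤ e₁ := by
  constructor
  · by_contra! hlt
    obtain ⟨x, hx, hpx⟩ := h.exists_eq hlt
    have := h.sq x ⟨hx.1, hx.2.le⟩
    rw [hpx, sub_self, mul_zero, zero_mul] at this
    exact h.ne x hx (pow_eq_zero_iff two_ne_zero |>.1 this)
  · by_contra! hlt
    obtain ⟨x, hx, hpx⟩ := h.exists_eq hlt
    have := h.sq x ⟨hx.1, hx.2.le⟩
    rw [hpx, sub_self, mul_zero] at this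
    exact h.ne x hx (pow_eq_zero_iff two_ne_zero |>.1 this)

theorem continuous_ellipticK_integrand {k : ℝ} (hk : k ^ 2 < 1) :
    Continuous fun y : ℝ => 1 / Real.sqrt (1 - k ^ 2 * Real.sin y ^ 2) := by
  refine continuous_const.div (by fun_prop) fun y => (Real.sqrt_pos.2 ?_).ne'
  nlinarith [Real.sin_sq_le_one y, sq_nonneg k, sq_nonneg (Real.sin y)]

/-- The complete elliptic integral as the real half-period of a pendulum-type equation. -/
theorem IsDescent.ellipticK_eq (h : IsDescent a e₁ e₂ e₃ p p') (h32 : e₃ < e₂) (h21 : e₂ < e₁)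
    {k s : ℝ} (hs : 0 < s) (hs2 : s ^ 2 = e₁ - e₃) (hk : k ^ 2 * s ^ 2 = e₂ - e₃) :
    ellipticK k = s * a := by
  have hs2pos : 0 < s ^ 2 := by positivity
  have hk1 : k ^ 2 < 1 := by
    by_contra! hge
    nlinarith
  have hcont := continuous_ellipticK_integrand hk1
  set F : ℝ → ℝ := fun θ => ∫ y in (0 : ℝ)..θ, 1 / Real.sqrt (1 - k ^ 2 * Real.sin y ^ 2) with hF
  have hFd : ∀ θ, HasDerivAt F (1 / Real.sqrt (1 - k ^ 2 * Real.sin θ ^ 2)) θ := fun θ =>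
    (hcont.integral_hasStrictDerivAt 0 θ).hasDerivAt
  have hFc : Continuous F := continuous_iff_continuousAt.2 fun θ => (hFd θ).continuousAt
  -- The substitution sin φ = s/√(p - e₃) turns the equation into φ' = s√(1 - k² sin² φ), so F(φ(x))
  -- - s x is constant. It runs from φ = 0 at the pole to φ = π/2 at a.
  set φ : ℝ → ℝ := fun x => Real.arcsin (s / Real.sqrt (p x - e₃)) with hφ
  have hGd : ∀ x ∈ Set.Ioo 0 a, HasDerivAt (fun x => F (φ x) - s * x) 0 x := by
    intro x hx
    have hx' : x ∈ Set.Ioc 0 a := ⟨hx.1, hx.2.le⟩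
    have hgt := h.gt x hx
    set A := Real.sqrt (p x - e₁)
    set B := Real.sqrt (p x - e₂)
    set D := Real.sqrt (p x - e₃) with hD
    have hA : 0 < A := Real.sqrt_pos.2 (by linarith)
    have hB : 0 < B := Real.sqrt_pos.2 (by linarith)
    have hDp : 0 < D := Real.sqrt_pos.2 (by linarith)
    have hA2 : A ^ 2 = p x - e₁ := Real.sq_sqrt (by linarith)
    have hB2 : B ^ 2 = p x - e₂ := Real.sq_sqrt (by linarith)
    have hD2 : D ^ 2 = p x - e₃ := Real.sq_sqrt (by linarith)
    have hp' : p' x = -(2 * A * B * D) := by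
      have h1 : p' x ^ 2 = (2 * A * B * D) ^ 2 := by
        rw [h.sq x hx', ← hA2, ← hB2, ← hD2]
        ring
      rcases sq_eq_sq_iff_eq_or_eq_neg.1 h1 with h2 | h2
      · have := h.deriv_neg x hx
        have : 0 < 2 * A * B * D := by positivity
        linarith
      · exact h2
    have hu : HasDerivAt (fun x => s / Real.sqrt (p x - e₃)) (s * A * B / D ^ 2) x := by
      have h1 := ((h.hasDerivAt x hx').sub_const e₃).sqrt (by linarith)
      refine ((hasDerivAt_const x s).div h1 hDp.ne').congr_deriv ?_
      rw [hp', ← hD]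
      field_simp
      ring
    have hDA : 1 - (s / D) ^ 2 = (A / D) ^ 2 := by
      field_simp
      rw [hA2, hD2]
      linarith
    have hu1 : s / D < 1 := by
      have : 0 < (A / D) ^ 2 := by positivity
      nlinarith [div_pos hs hDp]
    have hu0 : 0 < s / D := div_pos hs hDp
    have hsq1 : Real.sqrt (1 - (s / D) ^ 2) = A / D := by
      rw [hDA, Real.sqrt_sq (by positivity)]
    have hsin : Real.sin (φ x) = s / D := Real.sin_arcsin (by linarith) (by linarith)
    have hsq2 : Real.sqrt (1 - k ^ 2 * Real.sin (φ x) ^ 2) = B / D := by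
      rw [hsin, show 1 - k ^ 2 * (s / D) ^ 2 = (B / D) ^ 2 by
        field_simp
        rw [hB2, hD2, hk]
        ring, Real.sqrt_sq (by positivity)]
    have hφd : HasDerivAt φ (1 / (A / D) * (s * A * B / D ^ 2)) x := by
      rw [← hsq1]
      exact (Real.hasDerivAt_arcsin (by linarith) (by linarith)).comp x hu
    have h1 := ((hFd (φ x)).comp x hφd).sub ((hasDerivAt_id x).const_mul s)
    refine h1.congr_deriv ?_
    rw [hsq2]
    field_simp
    ring
  obtain ⟨C, hC⟩ := isOpen_Ioo.exists_is_const_of_deriv_eq_zero isPreconnected_Ioo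
    (fun x hx => (hGd x hx).differentiableAt.differentiableWithinAt)
    (fun x hx => (hGd x hx).deriv)
  have hlim0 : Tendsto (fun x => F (φ x) - s * x) (𝓝[>] 0) (𝓝 0) := by
    have h1 : Tendsto (fun x => Real.sqrt (p x - e₃)) (𝓝[>] 0) atTop :=
      Real.tendsto_sqrt_atTop.comp (tendsto_atTop_add_const_right _ (-e₃) h.tendsto_atTop)
    have h2 : Tendsto φ (𝓝[>] 0) (𝓝 0) := by
      have := (Real.continuous_arcsin.tendsto 0).comp (h1.const_div_atTop s)
      rwa [Real.arcsin_zero] at this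
    have h3 : Tendsto (fun x : ℝ => s * x) (𝓝[>] 0) (𝓝 0) := by
      have : Continuous fun x : ℝ => s * x := by fun_prop
      simpa using (this.tendsto 0).mono_left (nhdsWithin_le_nhds (s := Set.Ioi 0))
    have h4 := ((hFc.tendsto 0).comp h2).sub h3
    have h5 : F 0 = 0 := by simp [hF]
    simpa [h5] using h4
  have hlima : Tendsto (fun x => F (φ x) - s * x) (𝓝[<] a) (𝓝 (ellipticK k - s * a)) := by
    have hpa : ContinuousAt p a := (h.hasDerivAt a ⟨h.pos, le_rfl⟩).continuousAt
    have hsa : Real.sqrt (p a - e₃) = s := by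
      rw [h.end_eq, ← hs2, Real.sqrt_sq hs.le]
    have hφa : φ a = Real.pi / 2 := by
      simp only [hφ]
      rw [hsa, div_self hs.ne', Real.arcsin_one]
    have hφc : ContinuousAt φ a := by
      refine Real.continuous_arcsin.continuousAt.comp (f := fun x => s / Real.sqrt (p x - e₃)) ?_
      exact continuousAt_const.div (hpa.sub continuousAt_const).sqrt (by rw [hsa]; exact hs.ne')
    have hc : ContinuousAt (fun x => F (φ x) - s * x) a :=
      (hFc.continuousAt.comp hφc).sub (by fun_prop)
    have := hc.tendsto.mono_left (nhdsWithin_le_nhds (s := Set.Iio a))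
    rwa [hφa] at this
  have e0 : C = 0 := by
    refine tendsto_nhds_unique ?_ hlim0
    refine tendsto_const_nhds.congr' ?_
    filter_upwards [Ioo_mem_nhdsGT h.pos] with x hx using (hC x hx).symm
  have ea : C = ellipticK k - s * a := by
    refine tendsto_nhds_unique ?_ hlima
    refine tendsto_const_nhds.congr' ?_
    filter_upwards [Ioo_mem_nhdsLT h.pos] with x hx using (hC x hx).symm
  linarith

theorem ellipticK_lt {k k' : ℝ} (h : k ^ 2 < k' ^ 2) (hk' : k' ^ 2 < 1) :
    ellipticK k < ellipticK k' := by
  have hk := h.trans hk'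
  refine intervalIntegral.integral_lt_integral_of_continuousOn_of_le_of_exists_lt (by positivity)
    (continuous_ellipticK_integrand hk).continuousOn
    (continuous_ellipticK_integrand hk').continuousOn (fun y _ => ?_)
    ⟨Real.pi / 2, ⟨by positivity, le_rfl⟩, ?_⟩
  · have h1 : 0 < 1 - k' ^ 2 * Real.sin y ^ 2 := by
      nlinarith [Real.sin_sq_le_one y, sq_nonneg k', sq_nonneg (Real.sin y)]
    refine one_div_le_one_div_of_le (Real.sqrt_pos.2 h1) (Real.sqrt_le_sqrt ?_)
    nlinarith [sq_nonneg (Real.sin y)]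
  · simp only [Real.sin_pi_div_two, one_pow, mul_one]
    exact one_div_lt_one_div_of_lt (Real.sqrt_pos.2 (by linarith))
      (Real.sqrt_lt_sqrt (by linarith) (by linarith))

/-- The modulus and the scale of a rectangular lattice are determined by its half-periods. -/
theorem modulus_scale_unique {k k' s s' : ℝ} (hk : k ^ 2 < 1) (hk' : k' ^ 2 < 1)
    (hs : 0 < s) (hs' : 0 < s')
    (h1 : ellipticK k / s = ellipticK k' / s')
    (h2 : ellipticK (Real.sqrt (1 - k ^ 2)) / s = ellipticK (Real.sqrt (1 - k' ^ 2)) / s')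
    (h0 : 0 < k ^ 2) (h0' : 0 < k' ^ 2) : k ^ 2 = k' ^ 2 ∧ s = s' := by
  -- A larger modulus makes K larger and the complementary integral smaller, so equal real
  -- half-periods would need s < s' and equal imaginary ones s > s'.
  have key : ∀ {k k' s s' : ℝ}, 0 < k ^ 2 → k' ^ 2 < 1 → 0 < s → 0 < s' → k ^ 2 < k' ^ 2 →
      ellipticK k / s = ellipticK k' / s' →
      ellipticK (Real.sqrt (1 - k ^ 2)) / s = ellipticK (Real.sqrt (1 - k' ^ 2)) / s' → False := by
    intro k k' s s' h0 hk' hs hs' hlt h1 h2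
    have a1 := ellipticK_lt hlt hk'
    have a2 : ellipticK (Real.sqrt (1 - k' ^ 2)) < ellipticK (Real.sqrt (1 - k ^ 2)) := by
      refine ellipticK_lt ?_ ?_ <;> rw [Real.sq_sqrt (by linarith)]
      · rw [Real.sq_sqrt (by linarith)]
        linarith
      · linarith
    have p1 := ellipticK_pos (hlt.trans hk')
    have p2 : 0 < ellipticK (Real.sqrt (1 - k' ^ 2)) :=
      ellipticK_pos (by rw [Real.sq_sqrt (by linarith)]; linarith)
    rw [div_eq_div_iff hs.ne' hs'.ne'] at h1 h2
    rcases le_or_gt s s' with hle | hle <;> nlinarith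
  rcases lt_trichotomy (k ^ 2) (k' ^ 2) with hlt | heq | hlt
  · exact (key h0 hk' hs hs' hlt h1 h2).elim
  · refine ⟨heq, ?_⟩
    have hK : ellipticK k = ellipticK k' := by simp only [ellipticK, heq]
    rw [hK, div_eq_div_iff hs.ne' hs'.ne'] at h1
    exact (mul_left_cancel₀ (ellipticK_pos hk').ne' h1).symm
  · exact (key h0' hk hs' hs hlt h1.symm h2.symm).elim

end RealElliptic

/-! ### Rectangular lattices and their half-period values -/

section Rectangular

/-- The periods of `L` are `2 a` and `2 b i` with `a, b > 0`. -/
structure IsRectangular (L : PeriodPair) (a b : ℝ) : Prop where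
  a_pos : 0 < a
  b_pos : 0 < b
  ω₁_eq : L.ω₁ = 2 * (a : ℂ)
  ω₂_eq : L.ω₂ = 2 * (b : ℂ) * Complex.I

variable {L : PeriodPair} {a b : ℝ}

theorem IsRectangular.mem_iff (h : IsRectangular L a b) {z : ℂ} :
    z ∈ L.lattice ↔ (∃ m : ℤ, z.re = 2 * m * a) ∧ ∃ n : ℤ, z.im = 2 * n * b := by
  rw [PeriodPair.mem_lattice, h.ω₁_eq, h.ω₂_eq]
  constructor
  · rintro ⟨m, n, rfl⟩
    exact ⟨⟨m, by simp; ring⟩, ⟨n, by simp; ring⟩⟩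
  · rintro ⟨⟨m, hm⟩, ⟨n, hn⟩⟩
    refine ⟨m, n, ?_⟩
    apply Complex.ext
    · simp [hm]; ring
    · simp [hn]; ring

theorem IsRectangular.conj_mem_iff (h : IsRectangular L a b) {z : ℂ} :
    conj z ∈ L.lattice ↔ z ∈ L.lattice := by
  have key : ∀ z, z ∈ L.lattice → conj z ∈ L.lattice := by
    intro z hz
    rw [h.mem_iff] at hz ⊢
    obtain ⟨hm, n, hn⟩ := hz
    exact ⟨by simpa using hm, -n, by simp [hn]⟩
  exact ⟨fun hz => by simpa using key _ hz, key z⟩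

/-- Complex conjugation as a permutation of a rectangular lattice. -/
def IsRectangular.conjEquiv (h : IsRectangular L a b) : L.lattice ≃ L.lattice where
  toFun l := ⟨conj (l : ℂ), h.conj_mem_iff.2 l.2⟩
  invFun l := ⟨conj (l : ℂ), h.conj_mem_iff.2 l.2⟩
  left_inv l := by simp
  right_inv l := by simp

/-- Conjugation permutes the lattice, so it only reorders the series; the same holds for ℘' and ζ_w.
-/
theorem IsRectangular.weierstrassP_conj (h : IsRectangular L a b) (z : ℂ) :
    L.weierstrassP (conj z) = conj (L.weierstrassP z) := by
  rw [weierstrassP, weierstrassP, Complex.conj_tsum, ← h.conjEquiv.tsum_eq]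
  congr with l
  simp [IsRectangular.conjEquiv]

theorem IsRectangular.derivWeierstrassP_conj (h : IsRectangular L a b) (z : ℂ) :
    L.derivWeierstrassP (conj z) = conj (L.derivWeierstrassP z) := by
  rw [derivWeierstrassP, derivWeierstrassP, map_neg, Complex.conj_tsum, ← h.conjEquiv.tsum_eq]
  congr with l
  simp [IsRectangular.conjEquiv, map_ofNat]

theorem IsRectangular.weierstrassZeta_conj (h : IsRectangular L a b) (z : ℂ) :
    weierstrassZeta L (conj z) = conj (weierstrassZeta L z) := by
  rw [weierstrassZeta, weierstrassZeta, Complex.conj_tsum, ← h.conjEquiv.tsum_eq]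
  congr with l
  simp [IsRectangular.conjEquiv]

theorem not_int_mul {x a : ℝ} (hx : 0 < x) (hxa : x < 2 * a) (m : ℤ) : x ≠ 2 * m * a := by
  rintro rfl
  have ha : 0 < a := by linarith
  have h1 : (0 : ℝ) < m := by
    by_contra! hm
    nlinarith
  have h2 : (m : ℝ) < 1 := by
    by_contra! hm
    nlinarith
  have h3 : 0 < m := by exact_mod_cast h1
  have h4 : m < 1 := by exact_mod_cast h2
  omega

theorem IsRectangular.notMem_of_re (h : IsRectangular L a b) {z : ℂ} (h1 : 0 < z.re)
    (h2 : z.re < 2 * a) : z ∉ L.lattice := fun hz => by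
  obtain ⟨⟨m, hm⟩, -⟩ := h.mem_iff.1 hz
  exact not_int_mul h1 h2 m hm

theorem IsRectangular.notMem_of_im (h : IsRectangular L a b) {z : ℂ} (h1 : 0 < z.im)
    (h2 : z.im < 2 * b) : z ∉ L.lattice := fun hz => by
  obtain ⟨-, ⟨m, hm⟩⟩ := h.mem_iff.1 hz
  exact not_int_mul h1 h2 m hm

theorem ofReal_re_of_conj_eq {z : ℂ} (h : conj z = z) : (z.re : ℂ) = z :=
  Complex.conj_eq_iff_re.1 h

/-- The values of `℘` at the half-periods. -/
structure HalfPeriodValues (L : PeriodPair) (a b e₁ e₂ e₃ : ℝ) : Prop where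
  val₁ : L.weierstrassP a = e₁
  val₂ : L.weierstrassP (a + b * Complex.I) = e₂
  val₃ : L.weierstrassP (b * Complex.I) = e₃
  sq : ∀ z ∉ L.lattice, L.derivWeierstrassP z ^ 2 =
    4 * (L.weierstrassP z - e₁) * (L.weierstrassP z - e₂) * (L.weierstrassP z - e₃)
  sum : e₁ + e₂ + e₃ = 0
  g₂_eq : L.g₂ = -4 * (e₁ * e₂ + e₂ * e₃ + e₃ * e₁)
  ne₁₂ : e₁ ≠ e₂
  ne₂₃ : e₂ ≠ e₃
  ne₁₃ : e₁ ≠ e₃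

theorem IsRectangular.exists_halfPeriodValues (h : IsRectangular L a b) :
    ∃ e₁ e₂ e₃ : ℝ, HalfPeriodValues L a b e₁ e₂ e₃ := by
  have ha := h.a_pos
  have hb := h.b_pos
  have n1 : (a : ℂ) ∉ L.lattice := h.notMem_of_re (by simpa) (by simp; linarith)
  have n2 : (a + b * Complex.I : ℂ) ∉ L.lattice :=
    h.notMem_of_re (by simpa) (by simp; linarith)
  have n3 : (b * Complex.I : ℂ) ∉ L.lattice := h.notMem_of_im (by simpa) (by simp; linarith)
  have m1 : (2 * (a : ℂ)) ∈ L.lattice := h.ω₁_eq ▸ L.ω₁_mem_lattice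
  have m3 : (2 * (b * Complex.I : ℂ)) ∈ L.lattice := by
    rw [← mul_assoc, ← h.ω₂_eq]
    exact L.ω₂_mem_lattice
  have m2 : (2 * (a + b * Complex.I : ℂ)) ∈ L.lattice := by
    rw [mul_add]
    exact add_mem m1 m3
  have d1 := (derivWeierstrassP_eq_zero_iff L n1).2 m1
  have d2 := (derivWeierstrassP_eq_zero_iff L n2).2 m2
  have d3 := (derivWeierstrassP_eq_zero_iff L n3).2 m3
  -- Conjugation fixes each half-period up to sign and periods, so ℘ is real there.
  have r1 : ((L.weierstrassP a).re : ℂ) = L.weierstrassP a :=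
    ofReal_re_of_conj_eq (by rw [← h.weierstrassP_conj, Complex.conj_ofReal])
  have r2 : ((L.weierstrassP (a + b * Complex.I)).re : ℂ) = L.weierstrassP (a + b * Complex.I) := by
    refine ofReal_re_of_conj_eq ?_
    rw [← h.weierstrassP_conj, ← L.weierstrassP_sub_coe (a + b * Complex.I) ⟨_, m3⟩]
    congr 1
    simp
    ring
  have r3 : ((L.weierstrassP (b * Complex.I)).re : ℂ) = L.weierstrassP (b * Complex.I) := by
    refine ofReal_re_of_conj_eq ?_
    rw [← h.weierstrassP_conj, ← L.weierstrassP_neg (b * Complex.I)]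
    congr 1
    simp
  have k12 : L.weierstrassP a ≠ L.weierstrassP (a + b * Complex.I) := fun e => by
    have := sub_mem_lattice_of_eq L n1 n2 e (d1.trans d2.symm)
    rw [show (a : ℂ) - (a + b * Complex.I) = -(b * Complex.I) by ring] at this
    exact n3 (by simpa using this)
  have k23 : L.weierstrassP (a + b * Complex.I) ≠ L.weierstrassP (b * Complex.I) := fun e => by
    have := sub_mem_lattice_of_eq L n2 n3 e (d2.trans d3.symm)
    rw [add_sub_cancel_right] at this
    exact n1 this
  have k13 : L.weierstrassP a ≠ L.weierstrassP (b * Complex.I) := fun e => by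
    have := sub_mem_lattice_of_eq L n1 n3 e (d1.trans d3.symm)
    exact h.notMem_of_re (by simpa) (by simp; linarith) this
  have q1 := L.derivWeierstrassP_sq _ n1
  have q2 := L.derivWeierstrassP_sq _ n2
  have q3 := L.derivWeierstrassP_sq _ n3
  rw [d1] at q1
  rw [d2] at q2
  rw [d3] at q3
  have hsq := L.derivWeierstrassP_sq
  generalize hx : L.weierstrassP a = x at *
  generalize hy : L.weierstrassP (a + b * Complex.I) = y at *
  generalize hw : L.weierstrassP (b * Complex.I) = w at *
  -- Vieta by hand: the three distinct values are roots of 4X³ - g₂X - g₃, and divided differences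
  -- of the cubic give the symmetric functions.
  have s1 : 4 * (x ^ 2 + x * y + y ^ 2) - L.g₂ = 0 :=
    mul_left_cancel₀ (sub_ne_zero.2 k12) (by linear_combination q2 - q1)
  have s2 : 4 * (y ^ 2 + y * w + w ^ 2) - L.g₂ = 0 :=
    mul_left_cancel₀ (sub_ne_zero.2 k23) (by linear_combination q3 - q2)
  have s3 : x + y + w = 0 :=
    mul_left_cancel₀ (sub_ne_zero.2 k13) (by linear_combination (s1 - s2) / 4)
  have hg2 : L.g₂ = -4 * (x * y + y * w + w * x) := by
    linear_combination -s1 + 4 * (x + y) * s3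
  refine ⟨x.re, y.re, w.re, ⟨hx.trans r1.symm, hy.trans r2.symm, hw.trans r3.symm, fun z hz => ?_, ?_, ?_, ?_, ?_, ?_⟩⟩
  · rw [r1, r2, r3, hsq z hz]
    have hg3 : L.g₃ = 4 * x * y * w := by
      linear_combination q1 - x * hg2 + 4 * x ^ 2 * s3
    linear_combination (4 * (L.weierstrassP z) ^ 2) * s3 - L.weierstrassP z * hg2 - hg3
  · exact_mod_cast (by rw [r1, r2, r3]; exact s3 : (x.re : ℂ) + y.re + w.re = 0)
  · rw [r1, r2, r3]
    exact hg2
  · exact fun e => k12 (by rw [← r1, ← r2, e])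
  · exact fun e => k23 (by rw [← r2, ← r3, e])
  · exact fun e => k13 (by rw [← r1, ← r3, e])

variable {e₁ e₂ e₃ : ℝ}

theorem IsRectangular.isDescent_real (h : IsRectangular L a b)
    (he : HalfPeriodValues L a b e₁ e₂ e₃) :
    IsDescent a e₁ e₂ e₃ (fun x => (L.weierstrassP x).re)
      (fun x => (L.derivWeierstrassP x).re) := by
  have ha := h.a_pos
  have hmem : ∀ x ∈ Set.Ioc 0 a, (x : ℂ) ∉ L.lattice := fun x hx =>
    h.notMem_of_re (by simpa using hx.1) (by simp; linarith [hx.2])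
  have hP : ∀ x : ℝ, ((L.weierstrassP x).re : ℂ) = L.weierstrassP x := fun x =>
    ofReal_re_of_conj_eq (by rw [← h.weierstrassP_conj, Complex.conj_ofReal])
  have hP' : ∀ x : ℝ, ((L.derivWeierstrassP x).re : ℂ) = L.derivWeierstrassP x := fun x =>
    ofReal_re_of_conj_eq (by rw [← h.derivWeierstrassP_conj, Complex.conj_ofReal])
  refine ⟨ha, fun x hx => (hasDerivAt_weierstrassP L (hmem x hx)).real_of_complex,
    fun x hx => ?_, fun x hx h0 => ?_, ?_, by simp [he.val₁]⟩
  · have := he.sq x (hmem x hx)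
    rw [← hP, ← hP'] at this
    exact_mod_cast this
  · have h1 : L.derivWeierstrassP x = 0 := by rw [← hP', h0, Complex.ofReal_zero]
    have h2 := (derivWeierstrassP_eq_zero_iff L (hmem x ⟨hx.1, hx.2.le⟩)).1 h1
    exact h.notMem_of_re (by simpa using hx.1) (by simpa using hx.2) h2
  · have h1 : Tendsto (fun x : ℝ => 1 / x ^ 2) (𝓝[>] 0) atTop := by
      have := (tendsto_pow_atTop (α := ℝ) two_ne_zero).comp tendsto_inv_nhdsGT_zero
      refine this.congr fun x => ?_
      simp
    have h2 : ContinuousAt (fun x : ℝ => (L.weierstrassPExcept 0 x).re) 0 := by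
      have h3 := (L.analyticAt_weierstrassPExcept 0).continuousAt
      exact Complex.continuous_re.continuousAt.comp
        (ContinuousAt.comp (g := L.weierstrassPExcept 0) (f := fun x : ℝ => (x : ℂ))
          (by simpa using h3) Complex.continuous_ofReal.continuousAt)
    refine (h1.atTop_add (h2.tendsto.mono_left nhdsWithin_le_nhds)).congr fun x => ?_
    rw [weierstrassP_eq_except, Complex.add_re]
    congr 1
    rw [← Complex.ofReal_pow, ← Complex.ofReal_one, ← Complex.ofReal_div, Complex.ofReal_re]

/-- On the imaginary axis ℘ is real, ℘' is purely imaginary, and 1/z² tends to -∞. So -℘(iy)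
descends, with the roots negated and in reverse order. -/
theorem IsRectangular.isDescent_imag (h : IsRectangular L a b)
    (he : HalfPeriodValues L a b e₁ e₂ e₃) :
    IsDescent b (-e₃) (-e₂) (-e₁) (fun y => -(L.weierstrassP (y * Complex.I)).re)
      (fun y => (L.derivWeierstrassP (y * Complex.I)).im) := by
  have hb := h.b_pos
  have hmem : ∀ y ∈ Set.Ioc 0 b, (y * Complex.I : ℂ) ∉ L.lattice := fun x hx =>
    h.notMem_of_im (by simpa using hx.1) (by simp; linarith [hx.2])
  have hP : ∀ y : ℝ, ((L.weierstrassP (y * Complex.I)).re : ℂ) = L.weierstrassP (y * Complex.I) := by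
    intro y
    refine ofReal_re_of_conj_eq ?_
    rw [← h.weierstrassP_conj, ← L.weierstrassP_neg (y * Complex.I)]
    simp
  have hP' : ∀ y : ℝ, ((L.derivWeierstrassP (y * Complex.I)).im : ℂ) * Complex.I =
      L.derivWeierstrassP (y * Complex.I) := by
    intro y
    have h1 : conj (L.derivWeierstrassP (y * Complex.I)) = -L.derivWeierstrassP (y * Complex.I) := by
      rw [← h.derivWeierstrassP_conj, ← L.derivWeierstrassP_neg]
      simp
    have h2 := congrArg Complex.re h1
    simp only [Complex.conj_re, Complex.neg_re] at h2
    apply Complex.ext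
    · simp; linarith
    · simp
  refine ⟨hb, fun y hy => ?_, fun y hy => ?_, fun y hy h0 => ?_, ?_, by simp [he.val₃]⟩
  · have h1 : HasDerivAt (fun z : ℂ => L.weierstrassP (z * Complex.I))
        (L.derivWeierstrassP (y * Complex.I) * Complex.I) (y : ℂ) := by
      have h2 := (hasDerivAt_id (y : ℂ)).mul_const Complex.I
      rw [one_mul] at h2
      exact HasDerivAt.comp (y : ℂ) (h₂ := L.weierstrassP) (h := fun z : ℂ => z * Complex.I)
        (hasDerivAt_weierstrassP L (hmem y hy)) h2
    refine h1.real_of_complex.neg.congr_deriv ?_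
    simp
  · have := he.sq _ (hmem y hy)
    rw [← hP, ← hP', mul_pow, Complex.I_sq] at this
    have h2 : (L.derivWeierstrassP (y * Complex.I)).im ^ 2 * (-1) =
      4 * ((L.weierstrassP (y * Complex.I)).re - e₁) * ((L.weierstrassP (y * Complex.I)).re - e₂)
        * ((L.weierstrassP (y * Complex.I)).re - e₃) := by exact_mod_cast this
    linear_combination -h2
  · have h1 : L.derivWeierstrassP (y * Complex.I) = 0 := by
      rw [← hP', h0, Complex.ofReal_zero, zero_mul]
    have h2 := (derivWeierstrassP_eq_zero_iff L (hmem y ⟨hy.1, hy.2.le⟩)).1 h1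
    exact h.notMem_of_im (by simpa using hy.1) (by simpa using hy.2) h2
  · have h1 : Tendsto (fun x : ℝ => 1 / x ^ 2) (𝓝[>] 0) atTop := by
      have := (tendsto_pow_atTop (α := ℝ) two_ne_zero).comp tendsto_inv_nhdsGT_zero
      refine this.congr fun x => ?_
      simp
    have h2 : ContinuousAt (fun x : ℝ => -(L.weierstrassPExcept 0 (x * Complex.I)).re) 0 := by
      have h3 := (L.analyticAt_weierstrassPExcept 0).continuousAt
      have h4 : ContinuousAt (fun x : ℝ => (x : ℂ) * Complex.I) 0 := by fun_prop
      exact (Complex.continuous_re.continuousAt.comp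
        (ContinuousAt.comp (g := L.weierstrassPExcept 0) (f := fun x : ℝ => (x : ℂ) * Complex.I)
          (by simpa using h3) h4)).neg
    refine (h1.atTop_add (h2.tendsto.mono_left nhdsWithin_le_nhds)).congr fun x => ?_
    rw [weierstrassP_eq_except, Complex.add_re, neg_add]
    congr 1
    rw [mul_pow, Complex.I_sq, mul_neg_one, div_neg, Complex.neg_re, neg_neg,
      ← Complex.ofReal_pow, ← Complex.ofReal_one, ← Complex.ofReal_div, Complex.ofReal_re]

/-- The real descent puts e₁ on top, the imaginary one puts e₃ at the bottom. -/
theorem IsRectangular.order (h : IsRectangular L a b) (he : HalfPeriodValues L a b e₁ e₂ e₃) :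
    e₃ < e₂ ∧ e₂ < e₁ := by
  have h1 := (h.isDescent_real he).root_le
  have h2 := (h.isDescent_imag he).root_le
  exact ⟨lt_of_le_of_ne (by linarith) he.ne₂₃.symm, lt_of_le_of_ne h1.1 he.ne₁₂.symm⟩

/-- The half-period values of the rectangular lattice with half-periods `K(k)/s` and
`i K'(k)/s`. -/
theorem IsRectangular.values_of_modulus (h : IsRectangular L a b)
    (he : HalfPeriodValues L a b e₁ e₂ e₃) {k s : ℝ} (hs : 0 < s) (hk0 : 0 < k ^ 2)
    (hk1 : k ^ 2 < 1) (ha : a = ellipticK k / s)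
    (hb : b = ellipticK (Real.sqrt (1 - k ^ 2)) / s) :
    e₁ = s ^ 2 * (2 - k ^ 2) / 3 ∧ e₂ = s ^ 2 * (2 * k ^ 2 - 1) / 3 ∧
      e₃ = -(s ^ 2 * (1 + k ^ 2) / 3) := by
  obtain ⟨h32, h21⟩ := h.order he
  -- Scale and modulus read off from the half-period values; uniqueness will identify them with s
  -- and k.
  set s' := Real.sqrt (e₁ - e₃) with hs'
  have hs'pos : 0 < s' := Real.sqrt_pos.2 (by linarith)
  have hs2 : s' ^ 2 = e₁ - e₃ := Real.sq_sqrt (by linarith)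
  set k' := Real.sqrt ((e₂ - e₃) / (e₁ - e₃)) with hk'
  have hk2 : k' ^ 2 = (e₂ - e₃) / (e₁ - e₃) :=
    Real.sq_sqrt (div_nonneg (by linarith) (by linarith))
  have hks : k' ^ 2 * s' ^ 2 = e₂ - e₃ := by
    rw [hk2, hs2, div_mul_cancel₀ _ (by linarith)]
  have hk'0 : 0 < k' ^ 2 := by
    rw [hk2]
    exact div_pos (by linarith) (by linarith)
  have hk'1 : k' ^ 2 < 1 := by
    rw [hk2, div_lt_one (by linarith)]
    linarith
  have K1 := (h.isDescent_real he).ellipticK_eq h32 h21 hs'pos hs2 hks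
  -- For the roots -e₃, -e₂, -e₁ the squared modulus is (e₁-e₂)/(e₁-e₃) = 1 - k'².
  have K2 := (h.isDescent_imag he).ellipticK_eq (k := Real.sqrt (1 - k' ^ 2)) (s := s')
    (by linarith) (by linarith) hs'pos (by linarith) (by
      rw [Real.sq_sqrt (by linarith)]
      linear_combination hs2 - hks)
  obtain ⟨u1, u2⟩ := modulus_scale_unique hk1 hk'1 hs hs'pos
    (by rw [← ha, K1, mul_div_cancel_left₀ _ hs'pos.ne'])
    (by rw [← hb, K2, mul_div_cancel_left₀ _ hs'pos.ne']) hk0 hk'0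
  rw [← u1, ← u2] at hks
  rw [← u2] at hs2
  have := he.sum
  refine ⟨?_, ?_, ?_⟩ <;> linarith

end Rectangular

/-! ### Algebra of the wave parameters on the elliptic curve -/

section Band

/-- Here p = c-1, B = c+1, ε = E-1, z = ζ² and V = iζΩ. The relation between ζ and Ω is linear in ε;
after eliminating ε the cubic at ℘(ρ) becomes -z times a square, which is (2X)². -/
theorem cubic_at_rho {p B ε z V : ℂ} (hp : p ≠ 0) (hB : B ≠ 0) (hz : z ≠ 0)
    (hε : 64 * V ^ 2 = 8 * p * B * ε * z + p ^ 2 + 16 * B ^ 2 * z ^ 2) :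
    4 * (-(p * ε + 12 * B * z - 24 * V) / (6 * p ^ 2 * B) - ε / (3 * (p * B))) *
      ((-(p * ε + 12 * B * z - 24 * V) / (6 * p ^ 2 * B)) ^ 2
        + ε / (3 * (p * B)) * (-(p * ε + 12 * B * z - 24 * V) / (6 * p ^ 2 * B))
        + (ε ^ 2 - 9) / (36 * (p * B) ^ 2)) =
    -4 * z * (p * ε + 4 * B * z - 8 * V) ^ 2 / (p ^ 3 * B) ^ 2 := by
  obtain rfl : ε = (64 * V ^ 2 - p ^ 2 - 16 * B ^ 2 * z ^ 2) / (8 * p * B * z) := by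
    field_simp
    linear_combination -hε
  field_simp
  ring

/-- At Ω = 0 the half-slope of the tangent has the same value as that of the chord inside the band.
-/
theorem tangent_slope {p B ε τ : ℂ} (hp : p ≠ 0) (hB : B ≠ 0) (hτ : τ ≠ 0)
    (hX : p * ε - 4 * B * τ ^ 2 ≠ 0)
    (hε : 8 * p * B * ε * τ ^ 2 = p ^ 2 + 16 * B ^ 2 * τ ^ 4) :
    (6 * (-(p * ε - 12 * B * τ ^ 2) / (6 * p ^ 2 * B)) ^ 2 -
      (4 * (ε / (3 * (p * B))) ^ 2 - 4 * ((ε ^ 2 - 9) / (36 * (p * B) ^ 2))) / 2) /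
      (2 * (2 * (τ * (p * ε - 4 * B * τ ^ 2) / (p ^ 3 * B)))) = -2 * τ / p := by
  rw [div_eq_div_iff (mul_ne_zero two_ne_zero (mul_ne_zero two_ne_zero
    (div_ne_zero (mul_ne_zero hτ hX) (mul_ne_zero (pow_ne_zero _ hp) hB)))) hp]
  obtain rfl : ε = (p ^ 2 + 16 * B ^ 2 * τ ^ 4) / (8 * p * B * τ ^ 2) := by
    field_simp
    linear_combination hε
  field_simp
  ring

variable {c E : ℝ}

theorem IsRotational.sub_one_ne (h : IsRotational c E) : c - 1 ≠ 0 := by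
  intro hc
  obtain rfl : c = 1 := by linarith
  rcases h with ⟨h, -⟩ | ⟨h, -⟩ <;> norm_num at h

theorem IsRotational.add_one_ne (h : IsRotational c E) : c + 1 ≠ 0 := by
  intro hc
  obtain rfl : c = -1 := by linarith
  rcases h with ⟨h, -⟩ | ⟨h, -⟩ <;> norm_num at h

theorem IsRotational.one_lt_sq (h : IsRotational c E) : 1 < (E - 1) ^ 2 := by
  rcases h with ⟨-, h⟩ | ⟨-, h⟩ <;> nlinarith

theorem IsRotational.mul_pos (h : IsRotational c E) : 0 < (c ^ 2 - 1) * (E - 1) := by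
  rcases h with ⟨h1, h2⟩ | ⟨h1, h2⟩ <;> nlinarith

theorem isRectangular_periods (h : IsRotational c E) :
    IsRectangular (periods h) (omega1 c E) (omega3Im c E) :=
  ⟨h.omega1_pos, h.omega3Im_pos, rfl, rfl⟩

/-- The two regimes share e₁ but interchange the expressions for e₂ and e₃, so only the symmetric
quantity e₂e₃ is recorded. -/
theorem exists_values_periods (h : IsRotational c E) :
    ∃ e₁ e₂ e₃ : ℝ, HalfPeriodValues (periods h) (omega1 c E) (omega3Im c E) e₁ e₂ e₃ ∧
      e₁ = (E - 1) / (3 * ((c - 1) * (c + 1))) ∧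
      e₂ * e₃ = ((E - 1) ^ 2 - 9) / (36 * ((c - 1) * (c + 1)) ^ 2) := by
  obtain ⟨e₁, e₂, e₃, he⟩ := (isRectangular_periods h).exists_halfPeriodValues
  refine ⟨e₁, e₂, e₃, he, ?_⟩
  obtain ⟨rfl, rfl, rfl⟩ := (isRectangular_periods h).values_of_modulus he h.scale_pos
    h.modulus_sq.1 h.modulus_sq.2 rfl rfl
  have h1 := h.sub_one_ne
  have h2 := h.add_one_ne
  rcases h with ⟨hc, hE⟩ | ⟨hc, hE⟩
  · have e1 : 2 - E ≠ 0 := by linarith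
    have e2 : 1 - c ^ 2 = -((c - 1) * (c + 1)) := by ring
    have hk : modulus c E ^ 2 = 2 / (2 - E) := by
      rw [modulus, if_pos hc, Real.sq_sqrt (div_nonneg (by norm_num) (by linarith))]
    have hs : scale c E ^ 2 = (2 - E) / (2 * -((c - 1) * (c + 1))) := by
      rw [scale, if_pos hc, Real.sq_sqrt (div_nonneg (by linarith) (by linarith)), e2]
    rw [hk, hs]
    constructor
    · field_simp
      ring
    · field_simp
      ring
  · have e1 : E ≠ 0 := by linarith
    have e2 : c ^ 2 - 1 = (c - 1) * (c + 1) := by ring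
    have hk : modulus c E ^ 2 = 2 / E := by
      rw [modulus, if_neg (by linarith), Real.sq_sqrt (div_nonneg (by norm_num) (by linarith))]
    have hs : scale c E ^ 2 = E / (2 * ((c - 1) * (c + 1))) := by
      rw [scale, if_neg (by linarith), Real.sq_sqrt (div_nonneg (by linarith) (by linarith)), e2]
    rw [hk, hs]
    constructor
    · field_simp
    · field_simp
      ring

/-- The invariants of the lattice of a rotational wave, in terms of its parameters. -/
theorem periods_invariants (h : IsRotational c E) :
    (periods h).weierstrassP (omega1 c E) = ((E : ℂ) - 1) / (3 * (((c : ℂ) - 1) * ((c : ℂ) + 1))) ∧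
    (∀ z ∉ (periods h).lattice, (periods h).derivWeierstrassP z ^ 2 =
      4 * ((periods h).weierstrassP z - ((E : ℂ) - 1) / (3 * (((c : ℂ) - 1) * ((c : ℂ) + 1)))) *
      ((periods h).weierstrassP z ^ 2
        + ((E : ℂ) - 1) / (3 * (((c : ℂ) - 1) * ((c : ℂ) + 1))) * (periods h).weierstrassP z
        + (((E : ℂ) - 1) ^ 2 - 9) / (36 * (((c : ℂ) - 1) * ((c : ℂ) + 1)) ^ 2))) ∧
    (periods h).g₂ = 4 * (((E : ℂ) - 1) / (3 * (((c : ℂ) - 1) * ((c : ℂ) + 1)))) ^ 2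
      - 4 * ((((E : ℂ) - 1) ^ 2 - 9) / (36 * (((c : ℂ) - 1) * ((c : ℂ) + 1)) ^ 2)) := by
  obtain ⟨e₁, e₂, e₃, he, h1, h23⟩ := exists_values_periods h
  have c1 : (e₁ : ℂ) = ((E : ℂ) - 1) / (3 * (((c : ℂ) - 1) * ((c : ℂ) + 1))) := by
    rw [h1]
    push_cast
    rfl
  have c23 : (e₂ : ℂ) * e₃ =
      (((E : ℂ) - 1) ^ 2 - 9) / (36 * (((c : ℂ) - 1) * ((c : ℂ) + 1)) ^ 2) := by
    rw [← Complex.ofReal_mul, h23]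
    push_cast
    rfl
  have cs : (e₁ : ℂ) + e₂ + e₃ = 0 := by exact_mod_cast he.sum
  rw [← c1, ← c23]
  refine ⟨he.val₁, fun z hz => ?_, ?_⟩
  · rw [he.sq z hz]
    linear_combination (-4 * ((periods h).weierstrassP z - e₁) * (periods h).weierstrassP z) * cs
  · rw [he.g₂_eq]
    linear_combination (-4 * (e₁ : ℂ)) * cs

theorem cast_sub_one_ne (h : IsRotational c E) : (c : ℂ) - 1 ≠ 0 := by
  exact_mod_cast h.sub_one_ne

theorem cast_add_one_ne (h : IsRotational c E) : (c : ℂ) + 1 ≠ 0 := by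
  exact_mod_cast h.add_one_ne

theorem neg_C4_div_C5 (h : IsRotational c E) {ζ : ℂ} (hζ : ζ ≠ 0) (Ω : ℂ) :
    -C4 c E ζ Ω / C5 c ζ = -(((c : ℂ) - 1) * ((E : ℂ) - 1) + 12 * ((c : ℂ) + 1) * ζ ^ 2
      - 24 * (Complex.I * ζ * Ω)) / (6 * ((c : ℂ) - 1) ^ 2 * ((c : ℂ) + 1)) := by
  have h1 := cast_sub_one_ne h
  have h2 := cast_add_one_ne h
  rw [C4, C5]
  field_simp
  ring

theorem halfDerivP_eq (c E : ℝ) (ζ Ω : ℂ) :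
    halfDerivP c E ζ Ω = -Complex.I * ζ * (((c : ℂ) - 1) * ((E : ℂ) - 1)
      + 4 * ((c : ℂ) + 1) * ζ ^ 2 - 8 * (Complex.I * ζ * Ω)) /
      (((c : ℂ) - 1) ^ 3 * ((c : ℂ) + 1)) := by
  rw [halfDerivP]
  congr 1
  linear_combination (-8 * ζ ^ 2 * Ω) * Complex.I_sq

theorem OmegaSq_relation {ζ Ω : ℂ} (hζ : ζ ≠ 0) (hΩ : Ω ^ 2 = OmegaSq c E ζ) :
    64 * (Complex.I * ζ * Ω) ^ 2 = 8 * ((c : ℂ) - 1) * ((c : ℂ) + 1) * ((E : ℂ) - 1) * ζ ^ 2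
      + ((c : ℂ) - 1) ^ 2 + 16 * ((c : ℂ) + 1) ^ 2 * (ζ ^ 2) ^ 2 := by
  rw [mul_pow, mul_pow, Complex.I_sq, hΩ, OmegaSq]
  field_simp
  ring

theorem derivWeierstrassP_rho_sq (h : IsRotational c E) {ζ Ω ρ : ℂ} (hζ : ζ ≠ 0)
    (hΩ : Ω ^ 2 = OmegaSq c E ζ) (hρ : IsRho h ζ Ω ρ) :
    (periods h).derivWeierstrassP ρ ^ 2 = (2 * halfDerivP c E ζ Ω) ^ 2 := by
  rw [(periods_invariants h).2.1 ρ hρ.1, hρ.2, neg_C4_div_C5 h hζ,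
    cubic_at_rho (cast_sub_one_ne h) (cast_add_one_ne h) (pow_ne_zero 2 hζ)
      (OmegaSq_relation hζ hΩ), halfDerivP_eq]
  generalize ((c : ℂ) - 1) ^ 3 * ((c : ℂ) + 1) = D
  generalize ((c : ℂ) - 1) * ((E : ℂ) - 1) + 4 * ((c : ℂ) + 1) * ζ ^ 2
    - 8 * (Complex.I * ζ * Ω) = Q
  linear_combination (-4 * ζ ^ 2 * Q ^ 2 / D ^ 2) * Complex.I_sq

theorem IsRho.neg {h : IsRotational c E} {ζ Ω ρ : ℂ} (hρ : IsRho h ζ Ω ρ) : IsRho h ζ Ω (-ρ) :=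
  ⟨neg_notMem _ hρ.1, by rw [weierstrassP_neg, hρ.2]⟩

/-- Both ℘' and the zeta combination are odd in ρ. This allows the choice ℘'(ρ) = 2X. -/
theorem periodIntegral_neg (h : IsRotational c E) (ζ Ω ρ : ℂ) :
    periodIntegral h ζ Ω (-ρ) = periodIntegral h ζ Ω ρ := by
  rw [periodIntegral, periodIntegral, derivWeierstrassP_neg, weierstrassZeta_neg, div_neg]
  ring

theorem weierstrassZeta_add_int_mul (L : PeriodPair) {z η : ℂ} (l : L.lattice) (hz : z ∉ L.lattice)
    (hη : ∀ z ∉ L.lattice, weierstrassZeta L (z + l) = weierstrassZeta L z + η) (m : ℤ) :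
    weierstrassZeta L (z + m * l) = weierstrassZeta L z + m * η := by
  have hmem : ∀ m : ℤ, z + m * (l : ℂ) ∉ L.lattice := by
    intro m hm
    refine hz ((L.lattice.toAddSubgroup.add_mem_cancel_right (y := z) (x := m * l) ?_).1 hm)
    simpa using L.lattice.smul_mem m l.2
  induction m using Int.induction_on with
  | zero => simp
  | succ n ih =>
    have := hη _ (hmem n)
    push_cast at *
    rw [add_mul, one_mul, ← add_assoc, this, ih]
    ring
  | pred n ih =>
    have := hη _ (hmem (-n - 1))
    push_cast at *
    rw [show z + (-(n : ℂ) - 1) * l + l = z + -n * l by ring, ih] at this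
    linear_combination -this

/-- `ζ_w(x) ω₁ - ζ_w(ω₁) x` vanishes at the real points `x` congruent to `ω₁`. -/
theorem zeta_combination_eq_zero {L : PeriodPair} {a b : ℝ} (h : IsRectangular L a b) {x : ℝ}
    (hx : (x : ℂ) ∉ L.lattice) (hP : L.weierstrassP x = L.weierstrassP a) :
    weierstrassZeta L x * a - weierstrassZeta L a * x = 0 := by
  have ha : (a : ℂ) ∉ L.lattice :=
    h.notMem_of_re (by simpa using h.a_pos) (by simp; linarith [h.a_pos])
  have h2a : (2 * (a : ℂ)) ∈ L.lattice := h.ω₁_eq ▸ L.ω₁_mem_lattice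
  have hsub : (x : ℂ) - a ∈ L.lattice := by
    rcases sub_mem_or_add_mem_of_eq L hx ha hP with h1 | h1
    · exact h1
    · have := sub_mem h1 h2a
      rwa [show (x : ℂ) + a - 2 * a = x - a by ring] at this
  obtain ⟨⟨m, hm⟩, -⟩ := h.mem_iff.1 hsub
  have hxm : (x : ℂ) = a + m * ((⟨2 * (a : ℂ), h2a⟩ : L.lattice) : ℂ) := by
    have : x = a + 2 * m * a := by
      simp at hm
      linarith
    rw [this]
    push_cast
    ring
  -- Quasi-periodicity at -a together with oddness gives η = 2ζ_w(a), so ζ_w at (2m+1)a is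
  -- (2m+1)ζ_w(a).
  obtain ⟨η, hη⟩ := exists_quasiPeriod L ⟨2 * (a : ℂ), h2a⟩
  have h1 := hη _ (neg_notMem L ha)
  simp only [weierstrassZeta_neg] at h1
  rw [show -(a : ℂ) + 2 * a = a by ring] at h1
  rw [hxm, weierstrassZeta_add_int_mul L _ ha hη m]
  linear_combination (-(m : ℂ) * a) * h1

end Band

/-! ### Vanishing of the real part on the bands -/

section Band

variable {c E τ w : ℝ} {ρ : ℂ}

theorem I_mul_I_mul (τ w : ℝ) :
    Complex.I * (τ * Complex.I) * (w * Complex.I) = -(τ * w * Complex.I) := by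
  linear_combination (τ * w * Complex.I) * Complex.I_sq

theorem mul_I_sq (τ : ℝ) : ((τ : ℂ) * Complex.I) ^ 2 = -(τ : ℂ) ^ 2 := by
  rw [mul_pow, Complex.I_sq]
  ring

theorem halfDerivP_imag (h : IsRotational c E) (τ w : ℝ) :
    halfDerivP c E (τ * Complex.I) (w * Complex.I) =
      ((τ * ((c - 1) * (E - 1) - 4 * (c + 1) * τ ^ 2) / ((c - 1) ^ 3 * (c + 1)) : ℝ) : ℂ)
        + ((8 * τ ^ 2 * w / ((c - 1) ^ 3 * (c + 1)) : ℝ) : ℂ) * Complex.I := by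
  have h1 := cast_sub_one_ne h
  have h2 := cast_add_one_ne h
  rw [halfDerivP_eq, I_mul_I_mul, mul_I_sq, show -Complex.I * ((τ : ℂ) * Complex.I) = τ by
    linear_combination (-(τ : ℂ)) * Complex.I_sq]
  push_cast
  field_simp
  ring

theorem weierstrassP_rho_imag (h : IsRotational c E) (hτ : τ ≠ 0)
    (hρ : IsRho h (τ * Complex.I) (w * Complex.I) ρ) :
    (periods h).weierstrassP ρ =
      ((-((c - 1) * (E - 1) - 12 * (c + 1) * τ ^ 2) / (6 * (c - 1) ^ 2 * (c + 1)) : ℝ) : ℂ)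
        + ((-4 * τ * w / ((c - 1) ^ 2 * (c + 1)) : ℝ) : ℂ) * Complex.I := by
  have h1 := cast_sub_one_ne h
  have h2 := cast_add_one_ne h
  have hτ' : (τ : ℂ) ≠ 0 := by exact_mod_cast hτ
  rw [hρ.2, neg_C4_div_C5 h (mul_ne_zero hτ' Complex.I_ne_zero), I_mul_I_mul, mul_I_sq]
  push_cast
  field_simp
  ring

theorem conj_add_mul_I (x y : ℝ) :
    conj ((x : ℂ) + y * Complex.I) = (x : ℂ) - y * Complex.I := by
  simp [sub_eq_add_neg]

theorem two_mul_conj_slope (x y u v : ℂ) :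
    (2 * (x + y) - 2 * (x - y)) / (2 * ((u + v) - (u - v))) = y / v := by
  rw [show 2 * (x + y) - 2 * (x - y) = 4 * y by ring,
    show 2 * ((u + v) - (u - v)) = 4 * v by ring, mul_div_mul_left _ _ (by norm_num)]

/-- For w ≠ 0 the value ℘(ρ) is not real, so ρ and ±conj ρ are incongruent and the addition theorems
apply. The half-slope is Im X / Im ℘(ρ), from which w cancels; its square minus 2 Re ℘(ρ) is e₁. -/
theorem rho_add_conj_generic (h : IsRotational c E) (hτ : τ ≠ 0) (hw : w ≠ 0)
    (hρ : IsRho h (τ * Complex.I) (w * Complex.I) ρ)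
    (hX : (periods h).derivWeierstrassP ρ =
      2 * halfDerivP c E (τ * Complex.I) (w * Complex.I)) :
    ρ + conj ρ ∉ (periods h).lattice ∧
    (periods h).weierstrassP (ρ + conj ρ) = (periods h).weierstrassP (omega1 c E) ∧
    weierstrassZeta (periods h) (ρ + conj ρ) = weierstrassZeta (periods h) ρ
      + conj (weierstrassZeta (periods h) ρ) - 2 * τ / ((c : ℂ) - 1) := by
  have hr := isRectangular_periods h
  have h1 := h.sub_one_ne
  have h2 := h.add_one_ne
  have h1' := cast_sub_one_ne h
  have h2' := cast_add_one_ne h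
  have hρ' : conj ρ ∉ (periods h).lattice := fun hm => hρ.1 (hr.conj_mem_iff.1 hm)
  have eP := weierstrassP_rho_imag h hτ hρ
  have eP' := hr.weierstrassP_conj ρ
  have eX' := hr.derivWeierstrassP_conj ρ
  rw [hX, halfDerivP_imag h] at eX'
  rw [eP, conj_add_mul_I] at eP'
  rw [map_mul, conj_add_mul_I, map_ofNat] at eX'
  rw [halfDerivP_imag h] at hX
  have hne : (periods h).weierstrassP ρ ≠ (periods h).weierstrassP (conj ρ) := by
    rw [eP, eP']
    intro e
    have h3 := congrArg Complex.im e
    simp only [Complex.add_im, Complex.sub_im, Complex.ofReal_im, Complex.mul_im,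
      Complex.ofReal_re, Complex.I_im, Complex.I_re, mul_one, mul_zero, zero_add, add_zero,
      zero_sub] at h3
    have h4 : -4 * τ * w / ((c - 1) ^ 2 * (c + 1)) ≠ 0 := by positivity
    exact h4 (by linarith)
  have hadd : ρ + conj ρ ∉ (periods h).lattice := fun hm => hne (by
    have := (periods h).weierstrassP_sub_coe ρ ⟨_, hm⟩
    simp only at this
    rw [← this, ← weierstrassP_neg]
    congr 1
    ring)
  have hsub : ρ - conj ρ ∉ (periods h).lattice := fun hm => hne (by
    have := (periods h).weierstrassP_sub_coe ρ ⟨_, hm⟩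
    simp only at this
    rw [← this]
    congr 1
    ring)
  have hslope : halfSlope (periods h) ρ (conj ρ) = -2 * τ / ((c : ℂ) - 1) := by
    have hτ' : (τ : ℂ) ≠ 0 := by exact_mod_cast hτ
    have hw' : (w : ℂ) ≠ 0 := by exact_mod_cast hw
    have hI := Complex.I_ne_zero
    rw [halfSlope, hX, eX', eP, eP']
    rw [two_mul_conj_slope]
    push_cast
    field_simp
    ring
  refine ⟨hadd, ?_, ?_⟩
  · rw [weierstrassP_add _ hρ.1 hρ' hadd hsub, hslope, (periods_invariants h).1, eP, eP']
    push_cast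
    field_simp
    ring
  · rw [weierstrassZeta_add _ hρ.1 hρ' hadd hsub, hslope, hr.weierstrassZeta_conj]
    ring

/-- For w = 0 both ℘(ρ) and ℘'(ρ) are real, so conj ρ is congruent to ρ. Then ρ + conj ρ is 2ρ up to
a period, duplication replaces addition, and the quasi-period of conj ρ - ρ accounts for the
difference in ζ_w. -/
theorem rho_add_conj_endpoint (h : IsRotational c E) (hτ : τ ≠ 0)
    (hrel : 8 * (c - 1) * (c + 1) * (E - 1) * τ ^ 2 =
      (c - 1) ^ 2 + 16 * (c + 1) ^ 2 * τ ^ 4)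
    (hX0 : (c - 1) * (E - 1) - 4 * (c + 1) * τ ^ 2 ≠ 0)
    (hρ : IsRho h (τ * Complex.I) ((0 : ℝ) * Complex.I) ρ)
    (hX : (periods h).derivWeierstrassP ρ =
      2 * halfDerivP c E (τ * Complex.I) ((0 : ℝ) * Complex.I)) :
    ρ + conj ρ ∉ (periods h).lattice ∧
    (periods h).weierstrassP (ρ + conj ρ) = (periods h).weierstrassP (omega1 c E) ∧
    weierstrassZeta (periods h) (ρ + conj ρ) = weierstrassZeta (periods h) ρ
      + conj (weierstrassZeta (periods h) ρ) - 2 * τ / ((c : ℂ) - 1) := by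
  have hr := isRectangular_periods h
  have h1 := h.sub_one_ne
  have h2 := h.add_one_ne
  have h1' := cast_sub_one_ne h
  have h2' := cast_add_one_ne h
  have hτ' : (τ : ℂ) ≠ 0 := by exact_mod_cast hτ
  have hρ' : conj ρ ∉ (periods h).lattice := fun hm => hρ.1 (hr.conj_mem_iff.1 hm)
  have eP := weierstrassP_rho_imag h hτ hρ
  rw [halfDerivP_imag h] at hX
  simp only [mul_zero, zero_div, Complex.ofReal_zero, zero_mul, add_zero] at eP hX
  have hX' : (periods h).derivWeierstrassP ρ ≠ 0 := by
    rw [hX]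
    have : τ * ((c - 1) * (E - 1) - 4 * (c + 1) * τ ^ 2) / ((c - 1) ^ 3 * (c + 1)) ≠ 0 := by
      positivity
    exact mul_ne_zero two_ne_zero (by exact_mod_cast this)
  have h2ρ : 2 * ρ ∉ (periods h).lattice := fun hm =>
    hX' ((derivWeierstrassP_eq_zero_iff _ hρ.1).2 hm)
  have hl : conj ρ - ρ ∈ (periods h).lattice := by
    refine sub_mem_lattice_of_eq _ hρ' hρ.1 ?_ ?_
    · rw [hr.weierstrassP_conj, eP, Complex.conj_ofReal]
    · rw [hr.derivWeierstrassP_conj, hX, map_mul, Complex.conj_ofReal, map_ofNat]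
  have hslope : (6 * (periods h).weierstrassP ρ ^ 2 - (periods h).g₂ / 2) /
      (2 * (periods h).derivWeierstrassP ρ) = -2 * τ / ((c : ℂ) - 1) := by
    rw [(periods_invariants h).2.2, hX, eP]
    have := tangent_slope (p := (c : ℂ) - 1) (B := (c : ℂ) + 1) (ε := (E : ℂ) - 1) (τ := τ)
      h1' h2' hτ' (by exact_mod_cast hX0) (by exact_mod_cast hrel)
    rw [← this]
    push_cast
    rfl
  have e2 : ρ + conj ρ = 2 * ρ + (conj ρ - ρ) := by ring
  obtain ⟨η, hη⟩ := exists_quasiPeriod (periods h) ⟨conj ρ - ρ, hl⟩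
  have hη1 := hη ρ hρ.1
  have hη2 := hη (2 * ρ) h2ρ
  simp only at hη1 hη2
  rw [add_sub_cancel, hr.weierstrassZeta_conj] at hη1
  refine ⟨fun hm => h2ρ ?_, ?_, ?_⟩
  · have := sub_mem hm hl
    rwa [show ρ + conj ρ - (conj ρ - ρ) = 2 * ρ by ring] at this
  · rw [e2]
    have := (periods h).weierstrassP_add_coe (2 * ρ) ⟨_, hl⟩
    simp only at this
    rw [this, weierstrassP_two_mul _ hρ.1 h2ρ, hslope, (periods_invariants h).1, eP]
    push_cast
    field_simp
    ring
  · rw [e2, hη2, weierstrassZeta_two_mul _ hρ.1 h2ρ, hslope, hη1]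
    ring

/-- These are the real and imaginary parts of X up to nonzero factors. Both vanishing would give
(E-1)² = 1, which rotational waves exclude. -/
theorem halfDerivP_coeff_ne (h : IsRotational c E)
    (hrel : 64 * (τ * w) ^ 2 = 8 * (c - 1) * (c + 1) * (E - 1) * τ ^ 2
      - (c - 1) ^ 2 - 16 * (c + 1) ^ 2 * τ ^ 4) :
    (c - 1) * (E - 1) - 4 * (c + 1) * τ ^ 2 ≠ 0 ∨ w ≠ 0 := by
  by_contra! h'
  obtain ⟨h1, rfl⟩ := h'
  have : (c - 1) ^ 2 * ((E - 1) ^ 2 - 1) = 0 := by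
    linear_combination -hrel + ((c - 1) * (E - 1) - 4 * (c + 1) * τ ^ 2) * h1
  have h2 := h.sub_one_ne
  have h3 := h.one_lt_sq
  rcases mul_eq_zero.1 this with h4 | h4
  · exact h2 (pow_eq_zero_iff two_ne_zero |>.1 h4)
  · linarith

theorem halfDerivP_ne_zero (h : IsRotational c E) (hτ : τ ≠ 0)
    (hrel : 64 * (τ * w) ^ 2 = 8 * (c - 1) * (c + 1) * (E - 1) * τ ^ 2
      - (c - 1) ^ 2 - 16 * (c + 1) ^ 2 * τ ^ 4) :
    halfDerivP c E (τ * Complex.I) (w * Complex.I) ≠ 0 := by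
  have h1 := h.sub_one_ne
  have h2 := h.add_one_ne
  rw [halfDerivP_imag h]
  intro h0
  have hre := congrArg Complex.re h0
  have him := congrArg Complex.im h0
  simp only [Complex.add_re, Complex.add_im, Complex.ofReal_im, Complex.mul_im, Complex.mul_re,
    Complex.ofReal_re, Complex.I_im, Complex.I_re, mul_one, mul_zero, zero_add, add_zero,
    sub_zero, Complex.zero_re, Complex.zero_im] at hre him
  rcases halfDerivP_coeff_ne h hrel with h3 | h3
  · revert hre
    positivity
  · revert him
    positivity

theorem re_periodIntegral_of_eq (h : IsRotational c E) (hτ : τ ≠ 0)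
    (hrel : 64 * (τ * w) ^ 2 = 8 * (c - 1) * (c + 1) * (E - 1) * τ ^ 2
      - (c - 1) ^ 2 - 16 * (c + 1) ^ 2 * τ ^ 4)
    (hρ : IsRho h (τ * Complex.I) (w * Complex.I) ρ)
    (hX : (periods h).derivWeierstrassP ρ =
      2 * halfDerivP c E (τ * Complex.I) (w * Complex.I)) :
    (periodIntegral h (τ * Complex.I) (w * Complex.I) ρ).re = 0 := by
  have hr := isRectangular_periods h
  have h1 := cast_sub_one_ne h
  have hX0 := halfDerivP_ne_zero h hτ hrel
  obtain ⟨k1, k2, k3⟩ : ρ + conj ρ ∉ (periods h).lattice ∧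
    (periods h).weierstrassP (ρ + conj ρ) = (periods h).weierstrassP (omega1 c E) ∧
    weierstrassZeta (periods h) (ρ + conj ρ) = weierstrassZeta (periods h) ρ
      + conj (weierstrassZeta (periods h) ρ) - 2 * τ / ((c : ℂ) - 1) := by
    rcases eq_or_ne w 0 with rfl | hw
    · refine rho_add_conj_endpoint h hτ (by linear_combination -hrel) ?_ hρ hX
      simpa using halfDerivP_coeff_ne h hrel
    · exact rho_add_conj_generic h hτ hw hρ hX
  rw [Complex.add_conj] at k1 k2 k3
  have key := zeta_combination_eq_zero hr (by exact_mod_cast k1) (by exact_mod_cast k2)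
  have hQ : periodIntegral h (τ * Complex.I) (w * Complex.I) ρ =
      2 * (omega1 c E : ℂ) * (-τ + w * Complex.I) / ((c : ℂ) - 1)
      + 2 * (weierstrassZeta (periods h) ρ * (omega1 c E : ℂ)
        - weierstrassZeta (periods h) (omega1 c E : ℂ) * ρ) := by
    rw [periodIntegral, hX, show Complex.I * ((τ : ℂ) * Complex.I) = -τ by
      linear_combination (τ : ℂ) * Complex.I_sq]
    rw [mul_div_mul_right _ _ hX0]
    norm_num
  have hζ : conj (weierstrassZeta (periods h) (omega1 c E)) =
      weierstrassZeta (periods h) (omega1 c E) := by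
    rw [← hr.weierstrassZeta_conj, Complex.conj_ofReal]
  have hconj : conj (periodIntegral h (τ * Complex.I) (w * Complex.I) ρ) =
      2 * (omega1 c E : ℂ) * (-τ - w * Complex.I) / ((c : ℂ) - 1)
      + 2 * (conj (weierstrassZeta (periods h) ρ) * (omega1 c E : ℂ)
        - weierstrassZeta (periods h) (omega1 c E : ℂ) * conj ρ) := by
    rw [hQ]
    simp only [map_add, map_sub, map_mul, map_div₀, Complex.conj_ofReal, map_neg, Complex.conj_I,
      map_one, map_ofNat, hζ]
    ring
  have hsum := Complex.add_conj (periodIntegral h (τ * Complex.I) (w * Complex.I) ρ)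
  have hρρ := Complex.add_conj ρ
  -- The w terms cancel on conjugation; replacing ζ_w(ρ) + conj ζ_w(ρ) through the addition theorem
  -- leaves twice the vanishing zeta combination at 2 Re ρ.
  have hzero : periodIntegral h (τ * Complex.I) (w * Complex.I) ρ
      + conj (periodIntegral h (τ * Complex.I) (w * Complex.I) ρ) = 0 := by
    rw [hconj, hQ]
    rw [← hρρ] at key k3
    rw [k3] at key
    linear_combination 2 * key
  rw [hzero] at hsum
  have := congrArg Complex.re hsum
  simp only [Complex.zero_re, Complex.ofReal_re] at this
  linarith

theorem re_periodIntegral (h : IsRotational c E) (hτ : τ ≠ 0)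
    (hrel : 64 * (τ * w) ^ 2 = 8 * (c - 1) * (c + 1) * (E - 1) * τ ^ 2
      - (c - 1) ^ 2 - 16 * (c + 1) ^ 2 * τ ^ 4)
    (hΩ : ((w : ℂ) * Complex.I) ^ 2 = OmegaSq c E (τ * Complex.I))
    (hρ : IsRho h (τ * Complex.I) (w * Complex.I) ρ) :
    (periodIntegral h (τ * Complex.I) (w * Complex.I) ρ).re = 0 := by
  have hζ : (τ : ℂ) * Complex.I ≠ 0 := mul_ne_zero (by exact_mod_cast hτ) Complex.I_ne_zero
  rcases sq_eq_sq_iff_eq_or_eq_neg.1 (derivWeierstrassP_rho_sq h hζ hΩ hρ) with h1 | h1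
  · exact re_periodIntegral_of_eq h hτ hrel hρ h1
  · rw [← periodIntegral_neg]
    exact re_periodIntegral_of_eq h hτ hrel hρ.neg (by rw [derivWeierstrassP_neg, h1, neg_neg])

/-! ### The sign normalisation, the roots of Ω² and the bands -/

theorem principalArg_iff {z : ℂ} (hz : z ≠ 0) :
    PrincipalArg z ↔ 0 < z.re ∨ (z.re = 0 ∧ 0 < z.im) := by
  rw [PrincipalArg, Complex.neg_pi_div_two_lt_arg_iff, Complex.arg_le_pi_div_two_iff]
  constructor
  · rintro ⟨h1 | h1, h2 | h2⟩
    · exact .inl h1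
    · exact .inl h1
    · rcases h2.eq_or_lt with h3 | h3
      · refine .inr ⟨h3.symm, h1.lt_of_ne fun h4 => hz (Complex.ext h3.symm h4.symm)⟩
      · exact .inl h3
    · linarith
  · rintro (h1 | ⟨h1, h2⟩)
    · exact ⟨.inl h1, .inl h1.le⟩
    · exact ⟨.inr h2.le, .inl h1.ge⟩

theorem principalArg_neg_iff {z : ℂ} (hz : z ≠ 0) : PrincipalArg (-z) ↔ ¬ PrincipalArg z := by
  rw [principalArg_iff (neg_ne_zero.2 hz), principalArg_iff hz]
  simp only [Complex.neg_re, Complex.neg_im, not_or, not_and, not_lt]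
  constructor
  · rintro (h1 | ⟨h1, h2⟩)
    · exact ⟨by linarith, fun h => by linarith⟩
    · exact ⟨by linarith, fun h => by linarith⟩
  · rintro ⟨h1, h2⟩
    rcases h1.lt_or_eq with h3 | h3
    · exact .inl (by linarith)
    · refine .inr ⟨by linarith, ?_⟩
      have h4 : z.im ≠ 0 := fun h4 => hz (Complex.ext h3 h4)
      have := (h2 h3).lt_of_ne h4
      linarith

theorem principalArg_two_mul_iff {z : ℂ} (hz : z ≠ 0) : PrincipalArg (2 * z) ↔ PrincipalArg z := by
  rw [principalArg_iff (mul_ne_zero two_ne_zero hz), principalArg_iff hz]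
  simp

/-- The half-plane contains exactly one of ±X, so the normalised ρ has ℘'(ρ) = 2νX. -/
theorem bigI_eq_periodIntegral (h : IsRotational c E) {ζ Ω : ℂ} (hζ : ζ ≠ 0)
    (hΩ : Ω ^ 2 = OmegaSq c E ζ) (hX : halfDerivP c E ζ Ω ≠ 0) (hρ : IsRho h ζ Ω ρ)
    (hp : PrincipalArg ((periods h).derivWeierstrassP ρ)) :
    bigI h ζ Ω ρ = periodIntegral h ζ Ω ρ := by
  have key : 4 * halfDerivP c E ζ Ω / (periods h).derivWeierstrassP ρ = 2 * nu c E ζ Ω := by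
    rcases sq_eq_sq_iff_eq_or_eq_neg.1 (derivWeierstrassP_rho_sq h hζ hΩ hρ) with h1 | h1
    · rw [h1, principalArg_two_mul_iff hX] at hp
      rw [h1, nu, if_pos hp, mul_div_mul_right _ _ hX]
      norm_num
    · rw [h1, principalArg_neg_iff (mul_ne_zero two_ne_zero hX), principalArg_two_mul_iff hX] at hp
      rw [h1, nu, if_neg hp, div_neg, mul_div_mul_right _ _ hX]
      norm_num
  rw [bigI, periodIntegral, key]

theorem exists_rho (h : IsRotational c E) {ζ Ω : ℂ} (hζ : ζ ≠ 0)
    (hΩ : Ω ^ 2 = OmegaSq c E ζ) (hX : halfDerivP c E ζ Ω ≠ 0) :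
    ∃ ρ, IsRho h ζ Ω ρ ∧ PrincipalArg ((periods h).derivWeierstrassP ρ) := by
  obtain ⟨ρ, h1, h2⟩ := exists_weierstrassP_eq (periods h) (-C4 c E ζ Ω / C5 c ζ)
  have hρ : IsRho h ζ Ω ρ := ⟨h1, h2⟩
  by_cases hp : PrincipalArg ((periods h).derivWeierstrassP ρ)
  · exact ⟨ρ, hρ, hp⟩
  · refine ⟨-ρ, hρ.neg, ?_⟩
    rw [derivWeierstrassP_neg, principalArg_neg_iff]
    · exact hp
    · intro h0
      have := derivWeierstrassP_rho_sq h hζ hΩ hρ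
      rw [h0, zero_pow two_ne_zero] at this
      exact mul_ne_zero two_ne_zero hX (pow_eq_zero_iff two_ne_zero |>.1 this.symm)

/-- The larger (`sgn = 1`) and smaller (`sgn = -1`) value of `|ζ|` at a root of `Ω²`. -/
def rootSize (c E sgn : ℝ) : ℝ :=
  Real.sqrt (((c ^ 2 - 1) * (E - 1)
    + sgn * Real.sqrt (((c ^ 2 - 1) * (E - 1)) ^ 2 - (c ^ 2 - 1) ^ 2)) / (4 * (c + 1) ^ 2))

/-- On the imaginary axis Ω² = 0 is a quadratic equation in |ζ|². It has two distinct positive roots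
because (c²-1)(E-1) > 0 and (E-1)² > 1; the last two claims are Vieta's formulas. -/
theorem rootSize_spec (h : IsRotational c E) :
    0 < rootSize c E (-1) ∧ rootSize c E (-1) < rootSize c E 1 ∧
    rootSize c E (-1) ^ 2 + rootSize c E 1 ^ 2 =
      (c ^ 2 - 1) * (E - 1) / (2 * (c + 1) ^ 2) ∧
    rootSize c E (-1) ^ 2 * rootSize c E 1 ^ 2 = (c - 1) ^ 2 / (16 * (c + 1) ^ 2) := by
  have h1 := h.sub_one_ne
  have h2 := h.add_one_ne
  have hm := h.mul_pos
  have hd : 0 < (c ^ 2 - 1) ^ 2 := by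
    have : c ^ 2 - 1 ≠ 0 := by
      rw [show c ^ 2 - 1 = (c - 1) * (c + 1) by ring]
      exact mul_ne_zero h1 h2
    positivity
  have hdisc : 0 < ((c ^ 2 - 1) * (E - 1)) ^ 2 - (c ^ 2 - 1) ^ 2 := by
    rw [mul_pow]
    nlinarith [h.one_lt_sq]
  set m := (c ^ 2 - 1) * (E - 1) with hmdef
  set r := Real.sqrt (m ^ 2 - (c ^ 2 - 1) ^ 2) with hr
  have hrpos : 0 < r := Real.sqrt_pos.2 hdisc
  have hr2 : r ^ 2 = m ^ 2 - (c ^ 2 - 1) ^ 2 := Real.sq_sqrt hdisc.le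
  have hrm : r < m := by nlinarith
  have hB : 0 < (c + 1) ^ 2 := by positivity
  have p1 : 0 < (m + -1 * r) / (4 * (c + 1) ^ 2) := div_pos (by linarith) (by positivity)
  have p2 : (m + -1 * r) / (4 * (c + 1) ^ 2) < (m + 1 * r) / (4 * (c + 1) ^ 2) := by
    gcongr
    norm_num
  have s1 : rootSize c E (-1) ^ 2 = (m + -1 * r) / (4 * (c + 1) ^ 2) := Real.sq_sqrt p1.le
  have s2 : rootSize c E 1 ^ 2 = (m + 1 * r) / (4 * (c + 1) ^ 2) := Real.sq_sqrt (p1.trans p2).le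
  refine ⟨Real.sqrt_pos.2 p1, Real.sqrt_lt_sqrt p1.le p2, ?_, ?_⟩
  · rw [s1, s2]
    field_simp
    ring
  · rw [s1, s2]
    field_simp
    linear_combination -16 * hr2

theorem OmegaSq_factor (h : IsRotational c E) {ζ : ℂ} (hζ : ζ ≠ 0) :
    OmegaSq c E ζ = -(((c : ℂ) + 1) ^ 2 / (4 * ζ ^ 2)) *
      ((ζ ^ 2 + (rootSize c E (-1) : ℂ) ^ 2) * (ζ ^ 2 + (rootSize c E 1 : ℂ) ^ 2)) := by
  obtain ⟨-, -, h3, h4⟩ := rootSize_spec h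
  have h2 := cast_add_one_ne h
  have e3 : (rootSize c E (-1) : ℂ) ^ 2 + (rootSize c E 1 : ℂ) ^ 2 =
      ((c : ℂ) ^ 2 - 1) * ((E : ℂ) - 1) / (2 * ((c : ℂ) + 1) ^ 2) := by exact_mod_cast h3
  have e4 : (rootSize c E (-1) : ℂ) ^ 2 * (rootSize c E 1 : ℂ) ^ 2 =
      ((c : ℂ) - 1) ^ 2 / (16 * ((c : ℂ) + 1) ^ 2) := by exact_mod_cast h4
  rw [show (ζ ^ 2 + (rootSize c E (-1) : ℂ) ^ 2) * (ζ ^ 2 + (rootSize c E 1 : ℂ) ^ 2) =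
    ζ ^ 4 + ζ ^ 2 * ((rootSize c E (-1) : ℂ) ^ 2 + (rootSize c E 1 : ℂ) ^ 2)
      + (rootSize c E (-1) : ℂ) ^ 2 * (rootSize c E 1 : ℂ) ^ 2 by ring, e3, e4, OmegaSq]
  field_simp
  ring

theorem sq_add_sq_eq_zero_iff (ζ : ℂ) (x : ℝ) :
    ζ ^ 2 + (x : ℂ) ^ 2 = 0 ↔ ζ = x * Complex.I ∨ ζ = ((-x : ℝ) : ℂ) * Complex.I := by
  have : ζ ^ 2 + (x : ℂ) ^ 2 = (ζ - x * Complex.I) * (ζ - ((-x : ℝ) : ℂ) * Complex.I) := by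
    push_cast
    linear_combination (x : ℂ) ^ 2 * Complex.I_sq
  rw [this, mul_eq_zero, sub_eq_zero, sub_eq_zero]

theorem OmegaSq_eq_zero_iff (h : IsRotational c E) (ζ : ℂ) :
    (ζ ≠ 0 ∧ OmegaSq c E ζ = 0) ↔
      (ζ = rootSize c E (-1) * Complex.I ∨ ζ = ((-rootSize c E (-1) : ℝ) : ℂ) * Complex.I) ∨
      (ζ = rootSize c E 1 * Complex.I ∨ ζ = ((-rootSize c E 1 : ℝ) : ℂ) * Complex.I) := by
  obtain ⟨p1, p2, -, -⟩ := rootSize_spec h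
  have h2 := cast_add_one_ne h
  rw [← sq_add_sq_eq_zero_iff, ← sq_add_sq_eq_zero_iff, ← mul_eq_zero]
  constructor
  · rintro ⟨h0, h1⟩
    rw [OmegaSq_factor h h0] at h1
    refine (mul_eq_zero.1 h1).resolve_left (neg_ne_zero.2 (div_ne_zero (pow_ne_zero 2 h2) ?_))
    exact mul_ne_zero (by norm_num) (pow_ne_zero 2 h0)
  · intro h1
    have h0 : ζ ≠ 0 := by
      rintro rfl
      simp [p1.ne', (p1.trans p2).ne'] at h1
    refine ⟨h0, ?_⟩
    rw [OmegaSq_factor h h0, h1, mul_zero]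

theorem eq_mul_I_of_sq_nonpos {Ω : ℂ} {r : ℝ} (hr : r ≤ 0) (h : Ω ^ 2 = r) :
    Ω = (Ω.im : ℂ) * Complex.I := by
  have hre := congrArg Complex.re h
  have him := congrArg Complex.im h
  rw [sq] at hre him
  simp only [Complex.mul_re, Complex.mul_im, Complex.ofReal_re, Complex.ofReal_im] at hre him
  have : Ω.re = 0 := by
    by_contra h0
    have h1 : Ω.im = 0 := by
      have : Ω.re * Ω.im = 0 := by linarith
      exact (mul_eq_zero.1 this).resolve_left h0
    rw [h1] at hre
    have : 0 < Ω.re * Ω.re := mul_self_pos.2 h0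
    linarith
  apply Complex.ext <;> simp [this]

/-- Between the two root sizes the factors of Ω² have opposite signs or vanish, so Ω² ≤ 0 and Ω is
purely imaginary. -/
theorem band_conditions (h : IsRotational c E) {ζ Ω : ℂ} (hre : ζ.re = 0)
    (h1 : rootSize c E (-1) ^ 2 ≤ ζ.im ^ 2) (h2 : ζ.im ^ 2 ≤ rootSize c E 1 ^ 2)
    (hΩ : Ω ^ 2 = OmegaSq c E ζ) :
    ζ = (ζ.im : ℂ) * Complex.I ∧ Ω = (Ω.im : ℂ) * Complex.I ∧ ζ.im ≠ 0 ∧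
    64 * (ζ.im * Ω.im) ^ 2 = 8 * (c - 1) * (c + 1) * (E - 1) * ζ.im ^ 2
      - (c - 1) ^ 2 - 16 * (c + 1) ^ 2 * ζ.im ^ 4 := by
  obtain ⟨p1, p2, -, -⟩ := rootSize_spec h
  have hτ : ζ.im ≠ 0 := by
    intro h0
    rw [h0] at h1
    nlinarith
  have hζ : ζ = (ζ.im : ℂ) * Complex.I := by
    apply Complex.ext <;> simp [hre]
  have hζ0 : ζ ≠ 0 := fun h0 => hτ (by rw [h0, Complex.zero_im])
  have hr : Ω ^ 2 = (((c + 1) ^ 2 / (4 * ζ.im ^ 2) * ((rootSize c E (-1) ^ 2 - ζ.im ^ 2) *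
      (rootSize c E 1 ^ 2 - ζ.im ^ 2)) : ℝ) : ℂ) := by
    rw [hΩ, OmegaSq_factor h hζ0]
    have : ζ ^ 2 = -(ζ.im : ℂ) ^ 2 := by
      rw [← mul_I_sq, ← hζ]
    rw [this]
    push_cast
    rw [mul_neg, div_neg, neg_neg]
    ring
  have hΩI := eq_mul_I_of_sq_nonpos (mul_nonpos_of_nonneg_of_nonpos (by positivity)
    (mul_nonpos_of_nonpos_of_nonneg (by linarith) (by linarith))) hr
  refine ⟨hζ, hΩI, hτ, ?_⟩
  have hrel := OmegaSq_relation hζ0 hΩ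
  have e : Complex.I * ζ * Ω = -(ζ.im * Ω.im * Complex.I) := by
    rw [← I_mul_I_mul, ← hζ, ← hΩI]
  have e2 : ζ ^ 2 = -(ζ.im : ℂ) ^ 2 := by
    rw [← mul_I_sq, ← hζ]
  rw [e, e2, neg_sq, mul_pow, Complex.I_sq] at hrel
  have : (64 * (ζ.im * Ω.im) ^ 2 : ℂ) = 8 * (c - 1) * (c + 1) * (E - 1) * ζ.im ^ 2
      - (c - 1) ^ 2 - 16 * (c + 1) ^ 2 * ζ.im ^ 4 := by
    linear_combination -hrel
  exact_mod_cast this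

theorem band_properties (h : IsRotational c E) {ζ Ω : ℂ} (hre : ζ.re = 0)
    (h1 : rootSize c E (-1) ^ 2 ≤ ζ.im ^ 2) (h2 : ζ.im ^ 2 ≤ rootSize c E 1 ^ 2)
    (hΩ : Ω ^ 2 = OmegaSq c E ζ) :
    (∃ ρ, IsRho h ζ Ω ρ ∧ PrincipalArg ((periods h).derivWeierstrassP ρ)) ∧
    (∀ ρ, IsRho h ζ Ω ρ → PrincipalArg ((periods h).derivWeierstrassP ρ) →
      (bigI h ζ Ω ρ).re = 0) ∧
    ∀ ρ, IsRho h ζ Ω ρ → (periodIntegral h ζ Ω ρ).re = 0 := by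
  obtain ⟨hζ, hΩI, hτ, hrel⟩ := band_conditions h hre h1 h2 hΩ
  have hζ0 : ζ ≠ 0 := fun h0 => hτ (by rw [h0, Complex.zero_im])
  have hX : halfDerivP c E ζ Ω ≠ 0 := by
    rw [hζ, hΩI]
    exact halfDerivP_ne_zero h hτ hrel
  have hperiod : ∀ ρ, IsRho h ζ Ω ρ → (periodIntegral h ζ Ω ρ).re = 0 := by
    intro ρ hρ
    have := re_periodIntegral h hτ hrel (by rw [← hζ, ← hΩI, hΩ]) (by rwa [← hζ, ← hΩI])
      (ρ := ρ)
    rwa [← hζ, ← hΩI] at this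
  exact ⟨exists_rho h hζ0 hΩ hX,
    fun ρ hρ hp => by rw [bigI_eq_periodIntegral h hζ0 hΩ hX hρ hp, hperiod ρ hρ], hperiod⟩

theorem spectral_bands (h : IsRotational c E) : ∃ r : Fin 4 → ℂ,
    (∀ ζ : ℂ, (ζ ≠ 0 ∧ OmegaSq c E ζ = 0) ↔ ∃ j, r j = ζ) ∧
    (∀ j, (r j).re = 0) ∧ StrictMono (fun j => (r j).im) ∧
    ∀ ζ : ℂ, ζ.re = 0 →
      (((r 0).im ≤ ζ.im ∧ ζ.im ≤ (r 1).im) ∨ ((r 2).im ≤ ζ.im ∧ ζ.im ≤ (r 3).im)) →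
      ∀ Ω : ℂ, Ω ^ 2 = OmegaSq c E ζ →
        (∃ ρ, IsRho h ζ Ω ρ ∧ PrincipalArg ((periods h).derivWeierstrassP ρ)) ∧
        (∀ ρ, IsRho h ζ Ω ρ → PrincipalArg ((periods h).derivWeierstrassP ρ) →
          (bigI h ζ Ω ρ).re = 0) ∧
        ∀ ρ, IsRho h ζ Ω ρ → (periodIntegral h ζ Ω ρ).re = 0 := by
  obtain ⟨p1, p2, -, -⟩ := rootSize_spec h
  refine ⟨fun j => ((![-rootSize c E 1, -rootSize c E (-1), rootSize c E (-1),
    rootSize c E 1] j : ℝ) : ℂ) * Complex.I, fun ζ => ?_, fun j => by simp, ?_, ?_⟩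
  · rw [OmegaSq_eq_zero_iff h]
    constructor
    · rintro ((rfl | rfl) | (rfl | rfl))
      exacts [⟨2, rfl⟩, ⟨1, rfl⟩, ⟨3, rfl⟩, ⟨0, rfl⟩]
    · rintro ⟨j, rfl⟩
      fin_cases j
      exacts [.inr (.inr rfl), .inl (.inr rfl), .inl (.inl rfl), .inr (.inl rfl)]
  · rw [Fin.strictMono_iff_lt_succ]
    intro j
    fin_cases j <;> simp <;> linarith
  · intro ζ hre hband Ω hΩ
    simp only [Complex.mul_im, Complex.ofReal_re, Complex.ofReal_im, Complex.I_im, Complex.I_re,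
      mul_one, mul_zero, add_zero, Matrix.cons_val] at hband
    refine band_properties h hre ?_ ?_ hΩ <;> rcases hband with ⟨h1, h2⟩ | ⟨h1, h2⟩ <;> nlinarith

end Band

/-! ### Bounded solutions of Hill's equation and the stability spectrum -/

section Spectrum

theorem contDiff_two_of_hasDerivAt {g g' g'' : ℝ → ℂ} (h1 : ∀ z, HasDerivAt g (g' z) z)
    (h2 : ∀ z, HasDerivAt g' (g'' z) z) (hc : Continuous g'') : ContDiff ℝ 2 g := by
  have e1 : deriv g = g' := funext fun z => (h1 z).deriv
  have e2 : deriv g' = g'' := funext fun z => (h2 z).deriv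
  rw [show (2 : WithTop ℕ∞) = 1 + 1 by norm_num, contDiff_succ_iff_deriv]
  refine ⟨fun z => (h1 z).differentiableAt, by simp, ?_⟩
  rw [e1, contDiff_one_iff_deriv, e2]
  exact ⟨fun z => (h2 z).differentiableAt, hc⟩

/-- A bounded solution of Hill's equation `y'' = Q y`. -/
structure IsBoundedHillSolution (Q : ℝ → ℝ) (y y' : ℝ → ℂ) : Prop where
  hasDerivAt : ∀ z, HasDerivAt y (y' z) z
  hasDerivAt' : ∀ z, HasDerivAt y' (Q z * y z) z
  ne_zero : ∃ z, y z ≠ 0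
  bounded : ∃ M, ∀ z, ‖y z‖ ≤ M

variable {c E t : ℝ} {f : ℝ → ℝ}

/-- Put W₁ = e^{μz}y with μ = ict/(c²-1), the exponent that removes the first-order term. It is
purely imaginary, so boundedness is preserved. -/
theorem mem_stabilitySpectrum_of_hill (hd : c ^ 2 - 1 ≠ 0) (hf : Continuous f) {y y' : ℝ → ℂ}
    (hy : IsBoundedHillSolution
      (fun z => -Real.cos (f z) / (c ^ 2 - 1) - t ^ 2 / (c ^ 2 - 1) ^ 2) y y') :
    (t : ℂ) * Complex.I ∈ stabilitySpectrum c f := by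
  obtain ⟨h1, h2, ⟨z₀, hz₀⟩, M, hM⟩ := hy
  have hd' : (c : ℂ) ^ 2 - 1 ≠ 0 := by exact_mod_cast hd
  set Q : ℝ → ℝ := fun z => -Real.cos (f z) / (c ^ 2 - 1) - t ^ 2 / (c ^ 2 - 1) ^ 2 with hQ
  set μ : ℂ := (c * t / (c ^ 2 - 1)) * Complex.I with hμ
  have he : ∀ z : ℝ, HasDerivAt (fun z : ℝ => Complex.exp (μ * z)) (Complex.exp (μ * z) * μ) z := by
    intro z
    have := (((hasDerivAt_id (z : ℂ)).const_mul μ).cexp).comp_ofReal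
    simpa using this
  have hW1 : ∀ z : ℝ, HasDerivAt (fun z : ℝ => Complex.exp (μ * z) * y z)
      (Complex.exp (μ * z) * (μ * y z + y' z)) z := fun z =>
    ((he z).mul (h1 z)).congr_deriv (by ring)
  have hW2 : ∀ z : ℝ, HasDerivAt (fun z : ℝ => Complex.exp (μ * z) * (μ * y z + y' z))
      (Complex.exp (μ * z) * (μ ^ 2 * y z + 2 * μ * y' z + Q z * y z)) z := fun z =>
    ((he z).mul (((h1 z).const_mul μ).add (h2 z))).congr_deriv (by simp only [Pi.add_apply]; ring)
  have hyc : Continuous y := continuous_iff_continuousAt.2 fun z => (h1 z).continuousAt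
  have hyc' : Continuous y' := continuous_iff_continuousAt.2 fun z => (h2 z).continuousAt
  have hQc : Continuous Q := by fun_prop
  have hcd : ContDiff ℝ 2 (fun z : ℝ => Complex.exp (μ * z) * y z) :=
    contDiff_two_of_hasDerivAt hW1 hW2 (by fun_prop)
  have hnorm : ∀ z : ℝ, ‖Complex.exp (μ * z) * y z‖ = ‖y z‖ := by
    intro z
    have : μ * z = ((c * t / (c ^ 2 - 1) * z : ℝ) : ℂ) * Complex.I := by
      rw [hμ]
      push_cast
      ring
    rw [norm_mul, this, Complex.norm_exp_ofReal_mul_I, one_mul]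
  refine ⟨fun z => Complex.exp (μ * z) * y z, fun z => t * Complex.I * (Complex.exp (μ * z) * y z),
    hcd, contDiff_const.mul (hcd.of_le (by norm_num)),
    ⟨z₀, .inl (mul_ne_zero (Complex.exp_ne_zero _) hz₀)⟩,
    ⟨max M (|t| * M), fun z => ⟨?_, ?_⟩⟩, fun z => rfl, fun z => ?_⟩
  · rw [hnorm]
    exact (hM z).trans (le_max_left _ _)
  · rw [norm_mul, hnorm, norm_mul, Complex.norm_I, mul_one, Complex.norm_real, Real.norm_eq_abs]
    exact (mul_le_mul_of_nonneg_left (hM z) (abs_nonneg t)).trans (le_max_right _ _)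
  · have d1 : deriv (fun z : ℝ => Complex.exp (μ * z) * y z) =
        fun z : ℝ => Complex.exp (μ * z) * (μ * y z + y' z) := funext fun z => (hW1 z).deriv
    have d2 : deriv (fun z : ℝ => t * Complex.I * (Complex.exp (μ * z) * y z)) z =
        t * Complex.I * (Complex.exp (μ * z) * (μ * y z + y' z)) :=
      ((hW1 z).const_mul _).deriv
    rw [d1, d2, (hW2 z).deriv]
    have eμ : μ * ((c : ℂ) ^ 2 - 1) = c * t * Complex.I := by
      rw [hμ]
      field_simp
    have eQ : (Q z : ℂ) * ((c : ℂ) ^ 2 - 1) ^ 2 =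
        -Real.cos (f z) * ((c : ℂ) ^ 2 - 1) - t ^ 2 := by
      rw [hQ]
      push_cast
      field_simp
    dsimp only
    generalize Complex.exp (μ * z) = e
    generalize y z = u
    generalize y' z = v
    generalize (Q z : ℂ) = q at *
    generalize ((Real.cos (f z) : ℝ) : ℂ) = C at *
    refine mul_right_cancel₀ hd' ?_
    linear_combination (e * u * ((c : ℂ) ^ 2 - 1) * μ + 2 * e * v * ((c : ℂ) ^ 2 - 1)
      - e * u * c * t * Complex.I) * eμ + (e * u) * eQ - (e * u * t ^ 2) * Complex.I_sq

/-- The solution is y = √F exp(iκθ) with θ' = 1/F. Its logarithmic derivative g = F'/(2F) + iκ/F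
satisfies g' + g² = Q exactly by `hQ`, and |y| = √F is bounded. -/
theorem exists_hill_solution {Q F F₁ F₂ : ℝ → ℝ} {κ M : ℝ} (hF : ∀ z, 0 < F z)
    (hM : ∀ z, F z ≤ M) (h1 : ∀ z, HasDerivAt F (F₁ z) z) (h2 : ∀ z, HasDerivAt F₁ (F₂ z) z)
    (hQ : ∀ z, 2 * F z * F₂ z - F₁ z ^ 2 - 4 * Q z * F z ^ 2 = 4 * κ ^ 2) :
    ∃ y y', IsBoundedHillSolution Q y y' := by
  have hFc : Continuous F := continuous_iff_continuousAt.2 fun z => (h1 z).continuousAt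
  have hinv : Continuous fun z => 1 / F z := continuous_const.div hFc fun z => (hF z).ne'
  set θ : ℝ → ℝ := fun z => ∫ x in (0 : ℝ)..z, 1 / F x with hθ
  have hθd : ∀ z, HasDerivAt θ (1 / F z) z := fun z =>
    (hinv.integral_hasStrictDerivAt 0 z).hasDerivAt
  set y : ℝ → ℂ := fun z => Complex.exp (((1 / 2 * Real.log (F z) : ℝ) : ℂ)
    + ((κ * θ z : ℝ) : ℂ) * Complex.I) with hy
  set g : ℝ → ℂ := fun z => ((1 / 2 * (F₁ z / F z) : ℝ) : ℂ) + ((κ / F z : ℝ) : ℂ) * Complex.I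
    with hg
  have hyd : ∀ z, HasDerivAt y (y z * g z) z := by
    intro z
    have a1 := (((h1 z).log (hF z).ne').const_mul (1 / 2)).ofReal_comp
    have a2 := (((hθd z).const_mul κ).ofReal_comp).mul_const Complex.I
    refine (a1.add a2).cexp.congr_deriv ?_
    simp only [hy, hg, mul_one_div, Pi.add_apply]
  have hgd : ∀ z, HasDerivAt g
      (((1 / 2 * ((F₂ z * F z - F₁ z * F₁ z) / F z ^ 2) : ℝ) : ℂ)
        + (((-(κ * F₁ z)) / F z ^ 2 : ℝ) : ℂ) * Complex.I) z := by
    intro z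
    have a1 := (((h2 z).div (h1 z) (hF z).ne').const_mul (1 / 2)).ofReal_comp
    have a2 := (((hasDerivAt_const z κ).div (h1 z) (hF z).ne').ofReal_comp).mul_const Complex.I
    refine (a1.add a2).congr_deriv ?_
    simp
  refine ⟨y, fun z => y z * g z, hyd, fun z => ?_, ⟨0, Complex.exp_ne_zero _⟩,
    Real.exp (1 / 2 * Real.log M), fun z => ?_⟩
  · refine ((hyd z).mul (hgd z)).congr_deriv ?_
    have hFz : (F z : ℂ) ≠ 0 := by exact_mod_cast (hF z).ne'
    have hQz : 2 * (F z : ℂ) * F₂ z - F₁ z ^ 2 - 4 * Q z * F z ^ 2 = 4 * κ ^ 2 := by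
      exact_mod_cast hQ z
    have e : (Q z : ℂ) = (2 * F z * F₂ z - F₁ z ^ 2 - 4 * κ ^ 2) / (4 * F z ^ 2) := by
      field_simp
      linear_combination -hQz
    rw [e, hg]
    push_cast
    field_simp
    linear_combination (16 * (κ : ℂ) ^ 2 * y z) * Complex.I_sq
  · rw [hy, Complex.norm_exp]
    simp only [Complex.add_re, Complex.ofReal_re, Complex.mul_re, Complex.I_re, mul_zero,
      Complex.ofReal_im, Complex.I_im, mul_one, sub_self, add_zero]
    exact Real.exp_le_exp.2
      (mul_le_mul_of_nonneg_left (Real.log_le_log (hF z) (hM z)) (by norm_num))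

theorem IsStationary.hasDerivAt (hf : IsStationary c E f) (z : ℝ) :
    HasDerivAt f (deriv f z) z :=
  (hf.contDiff.differentiable (by norm_num) z).hasDerivAt

theorem IsStationary.hasDerivAt_deriv (hf : IsStationary c E f) (hd : c ^ 2 - 1 ≠ 0) (z : ℝ) :
    HasDerivAt (deriv f) (-Real.sin (f z) / (c ^ 2 - 1)) z := by
  have h1 : ContDiff ℝ 1 (deriv f) := by
    have h := hf.contDiff
    rw [show (2 : WithTop ℕ∞) = 1 + 1 by norm_num, contDiff_succ_iff_deriv] at h
    exact h.2.2
  have h2 := (h1.differentiable (by norm_num) z).hasDerivAt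
  refine h2.congr_deriv ?_
  rw [eq_div_iff hd]
  linarith [hf.pendulum z]

theorem IsStationary.deriv_sq (hf : IsStationary c E f) (hd : c ^ 2 - 1 ≠ 0) (z : ℝ) :
    deriv f z ^ 2 = 2 * (E - 1 + Real.cos (f z)) / (c ^ 2 - 1) := by
  rw [eq_div_iff hd]
  linarith [hf.energy z]

/-- Take F = σ(cos f + a), with σ = ±1 making it positive. The pendulum equation and the energy
reduce the first integral to 4κ² with κ² = t²(a²-1)/(c²-1)², nonnegative because |a| > 1. -/
theorem exists_hill_solution_interior (hf : IsStationary c E f) (hd : c ^ 2 - 1 ≠ 0) {σ a : ℝ}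
    (hσ : σ ^ 2 = 1) (ha : a = E - 1 - 2 * t ^ 2 / (c ^ 2 - 1)) (hpos : 1 < σ * a) :
    ∃ y y', IsBoundedHillSolution
      (fun z => -Real.cos (f z) / (c ^ 2 - 1) - t ^ 2 / (c ^ 2 - 1) ^ 2) y y' := by
  have hcos : ∀ z, -1 ≤ σ * Real.cos (f z) ∧ σ * Real.cos (f z) ≤ 1 := by
    intro z
    refine abs_le.1 (sq_le_one_iff_abs_le_one _ |>.1 ?_)
    rw [mul_pow, hσ, one_mul]
    exact Real.cos_sq_le_one _
  have ha2 : 0 ≤ a ^ 2 - 1 := by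
    have : (σ * a) ^ 2 = a ^ 2 := by rw [mul_pow, hσ, one_mul]
    nlinarith
  refine exists_hill_solution (F := fun z => σ * (Real.cos (f z) + a))
    (F₁ := fun z => σ * (-Real.sin (f z) * deriv f z))
    (F₂ := fun z => σ * (-(Real.cos (f z) * deriv f z) * deriv f z
      + -Real.sin (f z) * (-Real.sin (f z) / (c ^ 2 - 1))))
    (κ := Real.sqrt (t ^ 2 * (a ^ 2 - 1) / (c ^ 2 - 1) ^ 2)) (M := 1 + σ * a)
    (fun z => by linarith [hcos z]) (fun z => by linarith [hcos z])
    (fun z => ((hf.hasDerivAt z).cos.add_const a).const_mul σ)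
    (fun z => ((hf.hasDerivAt z).sin.neg.mul (hf.hasDerivAt_deriv hd z)).const_mul σ) fun z => ?_
  rw [Real.sq_sqrt (by positivity)]
  have h1 := hf.deriv_sq hd z
  have h2 := Real.sin_sq_add_cos_sq (f z)
  have e1 : -(Real.cos (f z) * deriv f z) * deriv f z
      + -Real.sin (f z) * (-Real.sin (f z) / (c ^ 2 - 1)) =
      -Real.cos (f z) * (2 * (E - 1 + Real.cos (f z)) / (c ^ 2 - 1))
        + (1 - Real.cos (f z) ^ 2) / (c ^ 2 - 1) := by
    rw [← h1, ← h2]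
    ring
  have e2 : (σ * (-Real.sin (f z) * deriv f z)) ^ 2 =
      (1 - Real.cos (f z) ^ 2) * (2 * (E - 1 + Real.cos (f z)) / (c ^ 2 - 1)) := by
    rw [← h1, ← h2, mul_pow, hσ]
    ring
  simp only [e1, e2]
  generalize Real.cos (f z) = C
  have e3 : E - 1 = a + 2 * t ^ 2 / (c ^ 2 - 1) := by linarith
  rw [e3]
  field_simp
  generalize c ^ 2 - 1 = d
  linear_combination (2 * (C + a) *
    (-C * 2 * (d * a + 2 * t ^ 2 + C * d) + (1 - C ^ 2) * d)
      + 4 * (C * d + t ^ 2) * (C + a) ^ 2) * hσ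

/-- At the subluminal end point 1 - cos f = 2 sin²(f/2) has no guaranteed positivity, but the root
sin(f/2) is itself a smooth solution. -/
theorem exists_hill_solution_sin (hf : IsStationary c E f) (hd : c ^ 2 - 1 ≠ 0) (hE : E ≠ 0)
    (ht : E - 1 - 2 * t ^ 2 / (c ^ 2 - 1) = -1) :
    ∃ y y', IsBoundedHillSolution
      (fun z => -Real.cos (f z) / (c ^ 2 - 1) - t ^ 2 / (c ^ 2 - 1) ^ 2) y y' := by
  have hE' : E = 2 * t ^ 2 / (c ^ 2 - 1) := by linarith
  refine ⟨fun z => ((Real.sin (f z / 2) : ℝ) : ℂ),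
    fun z => ((Real.cos (f z / 2) * (deriv f z / 2) : ℝ) : ℂ),
    fun z => ((hf.hasDerivAt z).div_const 2).sin.ofReal_comp, fun z => ?_, ?_,
    1, fun z => ?_⟩
  · have h1 := ((hf.hasDerivAt z).div_const 2).cos.mul ((hf.hasDerivAt_deriv hd z).div_const 2)
    refine h1.ofReal_comp.congr_deriv ?_
    rw [← Complex.ofReal_mul]
    congr 1
    have h2 := hf.deriv_sq hd z
    have h3 : Real.sin (f z) = 2 * Real.sin (f z / 2) * Real.cos (f z / 2) := by
      rw [← Real.sin_two_mul]
      ring_nf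
    have h4 : Real.cos (f z) = 2 * Real.cos (f z / 2) ^ 2 - 1 := by
      rw [← Real.cos_two_mul]
      ring_nf
    rw [h4, hE'] at h2
    rw [h3, h4]
    field_simp at h2 ⊢
    linear_combination (-Real.sin (f z / 2)) * h2
  -- If sin(f/2) vanished identically, f would be at rest with cos f = 1, and the energy would be E
  -- = 0.
  · by_contra! h0
    have h1 : ∀ z, Real.sin (f z / 2) = 0 := fun z => by exact_mod_cast h0 z
    have h2 : ∀ z, Real.cos (f z / 2) * (deriv f z / 2) = 0 := by
      intro z
      have h3 := ((hf.hasDerivAt z).div_const 2).sin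
      rw [funext h1] at h3
      exact h3.unique (hasDerivAt_const z 0)
    have h3 : deriv f 0 = 0 := by
      have h5 := Real.sin_sq_add_cos_sq (f 0 / 2)
      rw [h1 0] at h5
      rcases mul_eq_zero.1 (h2 0) with h4 | h4
      · rw [h4] at h5
        norm_num at h5
      · linarith
    have h4 : Real.cos (f 0) = 1 := by
      have h6 : Real.cos (f 0) = 1 - 2 * Real.sin (f 0 / 2) ^ 2 := by
        rw [Real.sin_sq_eq_half_sub, mul_div_cancel₀ _ two_ne_zero]
        ring
      rw [h6, h1 0]
      norm_num
    have := hf.energy 0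
    rw [h3, h4] at this
    exact hE (by linarith)
  · rw [Complex.norm_real]
    exact Real.abs_sin_le_one _

/-- The superluminal counterpart, from 1 + cos f = 2 cos²(f/2); it could vanish identically only at
rest with energy E = 2. -/
theorem exists_hill_solution_cos (hf : IsStationary c E f) (hd : c ^ 2 - 1 ≠ 0) (hE : E ≠ 2)
    (ht : E - 1 - 2 * t ^ 2 / (c ^ 2 - 1) = 1) :
    ∃ y y', IsBoundedHillSolution
      (fun z => -Real.cos (f z) / (c ^ 2 - 1) - t ^ 2 / (c ^ 2 - 1) ^ 2) y y' := by
  have hE' : E = 2 + 2 * t ^ 2 / (c ^ 2 - 1) := by linarith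
  refine ⟨fun z => ((Real.cos (f z / 2) : ℝ) : ℂ),
    fun z => ((-Real.sin (f z / 2) * (deriv f z / 2) : ℝ) : ℂ),
    fun z => ((hf.hasDerivAt z).div_const 2).cos.ofReal_comp, fun z => ?_, ?_,
    1, fun z => ?_⟩
  · have h1 := ((hf.hasDerivAt z).div_const 2).sin.neg.mul
      ((hf.hasDerivAt_deriv hd z).div_const 2)
    refine h1.ofReal_comp.congr_deriv ?_
    rw [← Complex.ofReal_mul]
    congr 1
    have h2 := hf.deriv_sq hd z
    have h3 : Real.sin (f z) = 2 * Real.sin (f z / 2) * Real.cos (f z / 2) := by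
      rw [← Real.sin_two_mul]
      ring_nf
    have h4 : Real.cos (f z) = 1 - 2 * Real.sin (f z / 2) ^ 2 := by
      rw [Real.sin_sq_eq_half_sub, mul_div_cancel₀ _ two_ne_zero]
      ring
    rw [h4, hE'] at h2
    rw [h3, h4]
    simp only [Pi.neg_apply]
    field_simp at h2 ⊢
    linear_combination (-Real.cos (f z / 2)) * h2
  · by_contra! h0
    have h1 : ∀ z, Real.cos (f z / 2) = 0 := fun z => by exact_mod_cast h0 z
    have h2 : ∀ z, -Real.sin (f z / 2) * (deriv f z / 2) = 0 := by
      intro z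
      have h3 := ((hf.hasDerivAt z).div_const 2).cos
      rw [funext h1] at h3
      exact h3.unique (hasDerivAt_const z 0)
    have h3 : deriv f 0 = 0 := by
      have h5 := Real.sin_sq_add_cos_sq (f 0 / 2)
      rw [h1 0] at h5
      rcases mul_eq_zero.1 (h2 0) with h4 | h4
      · rw [neg_eq_zero.1 h4] at h5
        norm_num at h5
      · linarith
    have h4 : Real.cos (f 0) = -1 := by
      have h6 : Real.cos (f 0) = 2 * Real.cos (f 0 / 2) ^ 2 - 1 := by
        rw [← Real.cos_two_mul]
        ring_nf
      rw [h6, h1 0]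
      norm_num
    have := hf.energy 0
    rw [h3, h4] at this
    exact hE (by linarith)
  · rw [Complex.norm_real]
    exact Real.abs_cos_le_one _

theorem sq_le_of_abs_le_lambda2 {x : ℝ} (hx : 0 ≤ x) (h1 : -Real.sqrt x ≤ t)
    (h2 : t ≤ Real.sqrt x) : t ^ 2 ≤ x := by
  rw [← Real.sq_sqrt hx]
  exact sq_le_sq' h1 h2

theorem mem_stabilitySpectrum (h : IsRotational c E) (hf : IsStationary c E f)
    (h1 : -lambda2 c E ≤ t) (h2 : t ≤ lambda2 c E) :
    (t : ℂ) * Complex.I ∈ stabilitySpectrum c f := by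
  suffices hs : c ^ 2 - 1 ≠ 0 ∧ ∃ y y', IsBoundedHillSolution
      (fun z => -Real.cos (f z) / (c ^ 2 - 1) - t ^ 2 / (c ^ 2 - 1) ^ 2) y y' by
    obtain ⟨hd, y, y', hy⟩ := hs
    exact mem_stabilitySpectrum_of_hill hd hf.contDiff.continuous hy
  rcases h with ⟨hc, hE⟩ | ⟨hc, hE⟩
  · have hd : c ^ 2 - 1 < 0 := by linarith
    refine ⟨hd.ne, ?_⟩
    rw [lambda2, if_pos hc] at h1 h2
    have ht := sq_le_of_abs_le_lambda2 (by nlinarith) h1 h2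
    have ha : E - 1 - 2 * t ^ 2 / (c ^ 2 - 1) ≤ -1 := by
      have : E ≤ 2 * t ^ 2 / (c ^ 2 - 1) := by
        rw [le_div_iff_of_neg hd]
        nlinarith
      linarith
    rcases ha.lt_or_eq with ha | ha
    · exact exists_hill_solution_interior hf hd.ne (σ := -1) (by norm_num) rfl (by linarith)
    · exact exists_hill_solution_sin hf hd.ne hE.ne ha
  · have hd : 0 < c ^ 2 - 1 := by linarith
    refine ⟨hd.ne', ?_⟩
    rw [lambda2, if_neg (by linarith)] at h1 h2
    have ht := sq_le_of_abs_le_lambda2 (by nlinarith) h1 h2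
    have ha : 1 ≤ E - 1 - 2 * t ^ 2 / (c ^ 2 - 1) := by
      have : 2 * t ^ 2 / (c ^ 2 - 1) ≤ E - 2 := by
        rw [div_le_iff₀ hd]
        nlinarith
      linarith
    rcases ha.lt_or_eq with ha | ha
    · exact exists_hill_solution_interior hf hd.ne' (σ := 1) (by norm_num) rfl (by linarith)
    · exact exists_hill_solution_cos hf hd.ne' hE.ne' ha.symm

end Spectrum

end SineGordon

end

theorem mainTheorem5 (c E : ℝ) (h : SineGordon.IsRotational c E) :
    (∃ r : Fin 4 → ℂ,
      (∀ ζ : ℂ, (ζ ≠ 0 ∧ SineGordon.OmegaSq c E ζ = 0) ↔ ∃ j, r j = ζ) ∧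
      (∀ j, (r j).re = 0) ∧
      StrictMono (fun j => (r j).im) ∧
      ∀ ζ : ℂ, ζ.re = 0 →
        (((r 0).im ≤ ζ.im ∧ ζ.im ≤ (r 1).im) ∨ ((r 2).im ≤ ζ.im ∧ ζ.im ≤ (r 3).im)) →
        ∀ Ω : ℂ, Ω ^ 2 = SineGordon.OmegaSq c E ζ →
          (∃ ρ : ℂ, SineGordon.IsRho h ζ Ω ρ ∧
            SineGordon.PrincipalArg ((SineGordon.periods h).derivWeierstrassP ρ)) ∧
          (∀ ρ : ℂ, SineGordon.IsRho h ζ Ω ρ →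
            SineGordon.PrincipalArg ((SineGordon.periods h).derivWeierstrassP ρ) →
            (SineGordon.bigI h ζ Ω ρ).re = 0) ∧
          (∀ ρ : ℂ, SineGordon.IsRho h ζ Ω ρ →
            (SineGordon.periodIntegral h ζ Ω ρ).re = 0)) ∧
    (∀ f : ℝ → ℝ, SineGordon.IsStationary c E f →
      ∀ t : ℝ, -SineGordon.lambda2 c E ≤ t → t ≤ SineGordon.lambda2 c E →
        (t : ℂ) * Complex.I ∈ SineGordon.stabilitySpectrum c f) := by
  exact ⟨SineGordon.spectral_bands h, fun _ hf _ h1 h2 => SineGordon.mem_stabilitySpectrum h hf h1 h2⟩
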